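/- Let $(M,L)$ be a (smooth) Finsler manifold of dimension $n\ge 3$: $L:TM\to\mathbb R$ is smooth on the slit tangent bundle $\mathcal TM=TM\setminus 0$, positive there, zero on the zero section, positively homogeneous of degree one in $y$, and the Finsler metric $g_{ij}=\tfrac12\,\partial^2L^2/\partial y^i\partial y^j$ is positive definite. Let $\nabla$ be the Cartan connection of $(M,L)$ on the pullback bundle $\pi^{-1}(TM)\to\mathcal TM$, $\beta$ its horizontal map (horizontal lift), $\stackrel{h}{\nabla}$ the associated $h$-covariant derivative, and let $$R(X,Y)Z=-\nabla_{\beta X}\nabla_{\beta Y}Z+\nabla_{\beta Y}\nabla_{\beta X}Z+\nabla_{[\beta X,\beta Y]}Z$$ for sections $X,Y,Z$ of $\pi^{-1}(TM)$ be its horizontal curvature. Put $\mathrm{Ric}(X,Y)=\mathrm{Tr}\{Z\mapsto R(X,Z)Y\}$, $r=\mathrm{Tr}_g\mathrm{Ric}$, $G(X,Y)Z=g(X,Z)Y-g(Y,Z)X$, and let $C=R-\frac{r}{n(n-1)}G$ be the concircular curvature tensor; let $\mathbf R(X,Y,Z,W)=g(R(X,Y)Z,W)$ and $\mathbf C(X,Y,Z,W)=g(C(X,Y)Z,W)$.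 For a scalar-valued tensor $\omega$ on $\pi^{-1}(TM)$ write $(R(X,Y)\omega)(Z_1,\dots,Z_k)=-\sum_s\omega(Z_1,\dots,R(X,Y)Z_s,\dots,Z_k)$. Suppose that $C$ is not identically zero and that $(M,L)$ is horizontally integrable, i.e. its horizontal distribution is completely integrable: the bracket of any two horizontal vector fields is horizontal. Suppose moreover that (i) $(M,L)$ is concircularly recurrent with recurrence form $A$, that is, $\stackrel{h}{\nabla}C=A\otimes C$, where $A$ is a smooth scalar $1$-form on $\pi^{-1}(TM)$, positively homogeneous of degree zero in $y$ and not identically zero; respectively (ii) $(M,L)$ is $2$-concircularly recurrent with recurrence form $\alpha$, that is, $\stackrel{h}{\nabla}\stackrel{h}{\nabla}C=\alpha\otimes C$, where $\alpha$ is a smooth scalar bilinear form on $\pi^{-1}(TM)$, positively homogeneous of degree zero in $y$ and not identically zero. Then: (a) $\stackrel{h}{\nabla}A$ (respectively $\alpha$) is symmetric at every point of the support of $C$, i.e. of the closure in $\mathcal TM$ of the set $\{C\neq0\}$; in particular it is symmetric on all of $\mathcal TM$ if $C$ vanishes nowhere, or merely vanishes on no non-empty open set. (b) $R(X,Y)\mathbf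 C=0$ on all of $\mathcal TM$, for all $X,Y$. (c) $R(X,Y)\mathbf R=0$ on all of $\mathcal TM$, for all $X,Y$. -/

import Mathlib

open scoped Manifold ContDiff

noncomputable section

namespace FinslerGeom

/-! ### Local Finsler geometry

A point of a coordinate domain of the slit tangent bundle is a pair `p = (x, y)` of
coordinates `x` and fibre coordinates `y`. In this part `ℓ` is the coordinate expression of the
fundamental function, and tensor fields on the pullback bundle `π⁻¹(TM)` are given by their
components, which are functions of `(x, y)`. -/

/-- Coordinates `(x, y)` on the tangent bundle. -/
abbrev Coord (n : ℕ) : Type := EuclideanSpace ℝ (Fin n) × EuclideanSpace ℝ (Fin n)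

/-- The `i`-th coordinate vector. -/
abbrev stdVec {n : ℕ} (i : Fin n) : EuclideanSpace ℝ (Fin n) := EuclideanSpace.single i 1

/-- `∂f/∂xⁱ`. -/
def dx {n : ℕ} (i : Fin n) (f : Coord n → ℝ) (p : Coord n) : ℝ :=
  fderiv ℝ f p (stdVec i, 0)

/-- `∂f/∂yⁱ`. -/
def dy {n : ℕ} (i : Fin n) (f : Coord n → ℝ) (p : Coord n) : ℝ :=
  fderiv ℝ f p (0, stdVec i)

/-- The Finsler metric `g_ij = ½ ∂²(ℓ²)/∂yⁱ∂yʲ`. -/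
def metric {n : ℕ} (ℓ : Coord n → ℝ) (i j : Fin n) (p : Coord n) : ℝ :=
  (1 / 2) * dy i (dy j (fun q => ℓ q ^ 2)) p

/-- The inverse metric `g^ij`. -/
def metricInv {n : ℕ} (ℓ : Coord n → ℝ) (i j : Fin n) (p : Coord n) : ℝ :=
  (Matrix.of fun a b => metric ℓ a b p)⁻¹ i j

/-- The spray coefficients `Gⁱ = ¼ g^ir (yᵏ ∂²(ℓ²)/∂xᵏ∂yʳ - ∂(ℓ²)/∂xʳ)`;
the geodesics are the solutions of `ẍⁱ + 2 Gⁱ(x, ẋ) = 0`. -/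
def spray {n : ℕ} (ℓ : Coord n → ℝ) (i : Fin n) (p : Coord n) : ℝ :=
  (1 / 4) * ∑ r, metricInv ℓ i r p *
    ((∑ k, p.2 k * dx k (dy r (fun q => ℓ q ^ 2)) p) - dx r (fun q => ℓ q ^ 2) p)

/-- The Cartan nonlinear connection `Nⁱ_j = ∂Gⁱ/∂yʲ`. -/
def nonlin {n : ℕ} (ℓ : Coord n → ℝ) (i j : Fin n) (p : Coord n) : ℝ :=
  dy j (spray ℓ i) p

/-- The derivative along the horizontal vector field `δ_j = ∂/∂xʲ - Nʳ_j ∂/∂yʳ`, the horizontal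
lift `β(∂_j)` of the `j`-th coordinate field. -/
def hder {n : ℕ} (ℓ : Coord n → ℝ) (j : Fin n) (f : Coord n → ℝ) (p : Coord n) : ℝ :=
  dx j f p - ∑ r, nonlin ℓ r j p * dy r f p

/-- The horizontal coefficients of the Cartan connection, `∇_{δ_k} ∂_j = Fⁱ_jk ∂_i`, where
`Fⁱ_jk = ½ g^ir (δ_j g_rk + δ_k g_rj - δ_r g_jk)`. -/
def hCoeff {n : ℕ} (ℓ : Coord n → ℝ) (i j k : Fin n) (p : Coord n) : ℝ :=
  (1 / 2) * ∑ r, metricInv ℓ i r p *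
    (hder ℓ j (metric ℓ r k) p + hder ℓ k (metric ℓ r j) p - hder ℓ r (metric ℓ j k) p)

/-- The vertical coefficients of the Cartan connection, `∇_{∂/∂yᵏ} ∂_j = Tⁱ_jk ∂_i`, where
`Tⁱ_jk = ½ g^ir ∂g_jk/∂yʳ`; these are also the components of the (h)hv-torsion. -/
def vCoeff {n : ℕ} (ℓ : Coord n → ℝ) (i j k : Fin n) (p : Coord n) : ℝ :=
  (1 / 2) * ∑ r, metricInv ℓ i r p * dy r (metric ℓ j k) p

/-- The vertical part of the brackets of horizontal fields:
`[δ_j, δ_k] = R̂ⁱ_jk ∂/∂yⁱ` with `R̂ⁱ_jk = δ_k Nⁱ_j - δ_j Nⁱ_k`. -/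
def hBracket {n : ℕ} (ℓ : Coord n → ℝ) (i j k : Fin n) (p : Coord n) : ℝ :=
  hder ℓ k (nonlin ℓ i j) p - hder ℓ j (nonlin ℓ i k) p

/-- The horizontal curvature of the Cartan connection: the `i`-th component of
`R(∂_j, ∂_k) ∂_h = -∇_{δ_j} ∇_{δ_k} ∂_h + ∇_{δ_k} ∇_{δ_j} ∂_h + ∇_{[δ_j, δ_k]} ∂_h`.
With this sign a space of constant curvature `c` has `R(X, Y) Z = c (g(X, Z) Y - g(Y, Z) X)`. -/
def curv {n : ℕ} (ℓ : Coord n → ℝ) (i j k h : Fin n) (p : Coord n) : ℝ :=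
  hder ℓ k (hCoeff ℓ i h j) p - hder ℓ j (hCoeff ℓ i h k) p
    + (∑ m, (hCoeff ℓ m h j p * hCoeff ℓ i m k p - hCoeff ℓ m h k p * hCoeff ℓ i m j p))
    + ∑ m, hBracket ℓ m j k p * vCoeff ℓ i h m p

/-- The horizontal Ricci tensor `Ric(X, Y) = Tr (Z ↦ R(X, Z) Y)`. -/
def ricci {n : ℕ} (ℓ : Coord n → ℝ) (j h : Fin n) (p : Coord n) : ℝ :=
  ∑ i, curv ℓ i j i h p

/-- The horizontal scalar curvature, the `g`-trace of the horizontal Ricci tensor. -/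
def scalarCurv {n : ℕ} (ℓ : Coord n → ℝ) (p : Coord n) : ℝ :=
  ∑ j, ∑ h, metricInv ℓ j h p * ricci ℓ j h p

/-- `G(∂_j, ∂_k) ∂_h = g(∂_j, ∂_h) ∂_k - g(∂_k, ∂_h) ∂_j`, `i`-th component. -/
def tensorG {n : ℕ} (ℓ : Coord n → ℝ) (i j k h : Fin n) (p : Coord n) : ℝ :=
  metric ℓ j h p * (if i = k then 1 else 0) - metric ℓ k h p * (if i = j then 1 else 0)

/-- The concircular curvature tensor `C = R - r / (n (n - 1)) G`: the `i`-th component of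
`C(∂_j, ∂_k) ∂_h`. -/
def concirc {n : ℕ} (ℓ : Coord n → ℝ) (i j k h : Fin n) (p : Coord n) : ℝ :=
  curv ℓ i j k h p - scalarCurv ℓ p / ((n : ℝ) * ((n : ℝ) - 1)) * tensorG ℓ i j k h p

/-- The concircular tensor as a vector-valued tensor with three arguments:
`concircT ℓ i J` is the `i`-th component of `C(∂_{J 0}, ∂_{J 1}) ∂_{J 2}`. -/
def concircT {n : ℕ} (ℓ : Coord n → ℝ) (i : Fin n) (J : Fin 3 → Fin n) (p : Coord n) : ℝ :=
  concirc ℓ i (J 0) (J 1) (J 2) p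

/-- The h-covariant derivative of a vector-valued tensor with `k` arguments. The
new argument, the direction of differentiation, is the first one:
`(∇T)(X, X₁, …, X_k) = ∇_{βX} (T(X₁, …, X_k)) - ∑_s T(X₁, …, ∇_{βX} X_s, …, X_k)`. -/
def hCovVec {n k : ℕ} (ℓ : Coord n → ℝ) (T : Fin n → (Fin k → Fin n) → Coord n → ℝ)
    (i : Fin n) (J : Fin (k + 1) → Fin n) (p : Coord n) : ℝ :=
  hder ℓ (J 0) (T i (Fin.tail J)) p
    + (∑ m, hCoeff ℓ i m (J 0) p * T m (Fin.tail J) p)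
    - ∑ s : Fin k, ∑ m, hCoeff ℓ m (Fin.tail J s) (J 0) p *
        T i (Function.update (Fin.tail J) s m) p

/-- The h-covariant derivative of a scalar-valued tensor with `k` arguments, with the
direction of differentiation as the first argument. -/
def hCovForm {n k : ℕ} (ℓ : Coord n → ℝ) (θ : (Fin k → Fin n) → Coord n → ℝ)
    (J : Fin (k + 1) → Fin n) (p : Coord n) : ℝ :=
  hder ℓ (J 0) (θ (Fin.tail J)) p
    - ∑ s : Fin k, ∑ m, hCoeff ℓ m (Fin.tail J s) (J 0) p *
        θ (Function.update (Fin.tail J) s m) p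

/-- `𝐑(X, Y, Z, W) = g(R(X, Y) Z, W)` on coordinate fields. -/
def boldR {n : ℕ} (ℓ : Coord n → ℝ) (J : Fin 4 → Fin n) (p : Coord n) : ℝ :=
  ∑ i, metric ℓ i (J 3) p * curv ℓ i (J 0) (J 1) (J 2) p

/-- `𝐂(X, Y, Z, W) = g(C(X, Y) Z, W)` on coordinate fields. -/
def boldC {n : ℕ} (ℓ : Coord n → ℝ) (J : Fin 4 → Fin n) (p : Coord n) : ℝ :=
  ∑ i, metric ℓ i (J 3) p * concirc ℓ i (J 0) (J 1) (J 2) p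

/-- The action of the endomorphism `R(∂_a, ∂_b)` as a derivation on a scalar-valued tensor:
`(R(X, Y) θ)(Z₁, …, Z_k) = -∑_s θ(Z₁, …, R(X, Y) Z_s, …, Z_k)`. -/
def curvAct {n k : ℕ} (ℓ : Coord n → ℝ) (a b : Fin n) (θ : (Fin k → Fin n) → Coord n → ℝ)
    (J : Fin k → Fin n) (p : Coord n) : ℝ :=
  -∑ s : Fin k, ∑ m, curv ℓ m a b (J s) p * θ (Function.update J s m) p

/-! ### Finsler manifolds -/

section Manifold

variable {n : ℕ} {M : Type*} [TopologicalSpace M] [ChartedSpace (EuclideanSpace ℝ (Fin n)) M]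
  [IsManifold (𝓡 n) ∞ M]

/-- The domain of the coordinates `(x, y)` on the slit tangent bundle induced by a chart. -/
def slitDomain (e : OpenPartialHomeomorph M (EuclideanSpace ℝ (Fin n))) : Set (Coord n) :=
  {p | p.1 ∈ e.target ∧ p.2 ≠ 0}

/-- The expression of a function on the tangent bundle in the coordinates of a chart. -/
def inChart (L : TangentBundle (𝓡 n) M → ℝ)
    (e : OpenPartialHomeomorph M (EuclideanSpace ℝ (Fin n))) (p : Coord n) : ℝ :=
  L (tangentMap (𝓡 n) (𝓡 n) e.symm ⟨p.1, p.2⟩)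

/-- `L` is a Finsler structure on the manifold `M`. -/
structure IsFinsler (L : TangentBundle (𝓡 n) M → ℝ) : Prop where
  smooth : ContMDiffOn (𝓡 n).tangent 𝓘(ℝ, ℝ) ∞ L {u | u.2 ≠ 0}
  zero : ∀ x : M, L ⟨x, 0⟩ = 0
  pos : ∀ (x : M) (y : TangentSpace (𝓡 n) x), y ≠ 0 → 0 < L ⟨x, y⟩
  homog : ∀ (x : M) (y : TangentSpace (𝓡 n) x) (t : ℝ), 0 < t → L ⟨x, t • y⟩ = t * L ⟨x, y⟩
  posDef : ∀ e ∈ IsManifold.maximalAtlas (𝓡 n) ∞ M, ∀ p ∈ slitDomain e,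
    (Matrix.of fun i j => metric (inChart L e) i j p).PosDef

/-- The horizontal distribution of the Cartan connection is completely integrable: the brackets
of the horizontal frame fields `δ_j` are horizontal. -/
def HorizontallyIntegrable (L : TangentBundle (𝓡 n) M → ℝ) : Prop :=
  ∀ e ∈ IsManifold.maximalAtlas (𝓡 n) ∞ M, ∀ p ∈ slitDomain e,
    ∀ i j k, hBracket (inChart L e) i j k p = 0

variable (n M) in
/-- A scalar `k`-form along the projection `TM → M` (a scalar-valued tensor on the pullback
bundle, not necessarily alternating): it assigns to `(x, y)` a `k`-linear form on `T_x M`. -/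
abbrev PiForm (k : ℕ) : Type _ :=
  (x : M) → TangentSpace (𝓡 n) x →
    MultilinearMap ℝ (fun _ : Fin k => TangentSpace (𝓡 n) x) ℝ

/-- The components of a form in a chart. -/
def formComp {k : ℕ} (θ : PiForm n M k)
    (e : OpenPartialHomeomorph M (EuclideanSpace ℝ (Fin n)))
    (J : Fin k → Fin n) (p : Coord n) : ℝ :=
  θ (e.symm p.1) (mfderiv (𝓡 n) (𝓡 n) e.symm p.1 p.2)
    (fun s => mfderiv (𝓡 n) (𝓡 n) e.symm p.1 (stdVec (J s)))

/-- What is required of a recurrence form: on the slit tangent bundle it is smooth, positively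
homogeneous of degree zero in `y`, and not identically zero. -/
structure IsRecurrenceForm {k : ℕ} (θ : PiForm n M k) : Prop where
  smooth : ∀ e ∈ IsManifold.maximalAtlas (𝓡 n) ∞ M, ∀ J,
    ContDiffOn ℝ ∞ (formComp θ e J) (slitDomain e)
  homog : ∀ (x : M) (y : TangentSpace (𝓡 n) x) (t : ℝ), y ≠ 0 → 0 < t → θ x (t • y) = θ x y
  nonzero : ∃ (x : M) (y : TangentSpace (𝓡 n) x), y ≠ 0 ∧ θ x y ≠ 0

/-- The points of a coordinate domain where the concircular curvature tensor is non-zero. -/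
def concircNonzero (L : TangentBundle (𝓡 n) M → ℝ)
    (e : OpenPartialHomeomorph M (EuclideanSpace ℝ (Fin n))) : Set (Coord n) :=
  {p | p ∈ slitDomain e ∧ ∃ i J, concircT (inChart L e) i J p ≠ 0}

/-- The concircular curvature tensor is not identically zero. -/
def ConcircNe (L : TangentBundle (𝓡 n) M → ℝ) : Prop :=
  ∃ e ∈ IsManifold.maximalAtlas (𝓡 n) ∞ M, (concircNonzero L e).Nonempty

/-- `(M, L)` is concircularly recurrent with recurrence form `A`: `∇C = A ⊗ C`. -/
structure ConcircularlyRecurrent (L : TangentBundle (𝓡 n) M → ℝ) (A : PiForm n M 1) : Prop where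
  concirc_ne : ConcircNe L
  form : IsRecurrenceForm A
  recurrent : ∀ e ∈ IsManifold.maximalAtlas (𝓡 n) ∞ M, ∀ p ∈ slitDomain e, ∀ i a j k h,
    hCovVec (inChart L e) (concircT (inChart L e)) i ![a, j, k, h] p =
      formComp A e ![a] p * concircT (inChart L e) i ![j, k, h] p

/-- `(M, L)` is 2-concircularly recurrent with recurrence form `α`: `∇∇C = α ⊗ C`. -/
structure TwoConcircularlyRecurrent (L : TangentBundle (𝓡 n) M → ℝ) (α : PiForm n M 2) :
    Prop where
  concirc_ne : ConcircNe L
  form : IsRecurrenceForm α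
  recurrent : ∀ e ∈ IsManifold.maximalAtlas (𝓡 n) ∞ M, ∀ p ∈ slitDomain e, ∀ i a b j k h,
    hCovVec (inChart L e) (hCovVec (inChart L e) (concircT (inChart L e))) i ![a, b, j, k, h] p =
      formComp α e ![a, b] p * concircT (inChart L e) i ![j, k, h] p

/-- `R(X, Y) 𝐂 = 0`. -/
def CurvActsTriviallyOnC (L : TangentBundle (𝓡 n) M → ℝ) : Prop :=
  ∀ e ∈ IsManifold.maximalAtlas (𝓡 n) ∞ M, ∀ p ∈ slitDomain e, ∀ a b J,
    curvAct (inChart L e) a b (boldC (inChart L e)) J p = 0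

/-- `R(X, Y) 𝐑 = 0`. -/
def CurvActsTriviallyOnR (L : TangentBundle (𝓡 n) M → ℝ) : Prop :=
  ∀ e ∈ IsManifold.maximalAtlas (𝓡 n) ∞ M, ∀ p ∈ slitDomain e, ∀ a b J,
    curvAct (inChart L e) a b (boldR (inChart L e)) J p = 0

end Manifold

end FinslerGeom

end

open FinslerGeom

namespace FinslerGeom

/-! Integrability makes the frame fields `δ_j` commute, and the coefficients `hCoeff` are symmetric
in their lower indices. Hence the Ricci identity for the h-covariant derivative has only a curvature
term (`hCovVec_hCovVec_sub`): the skew part of `∇∇T` is minus the derivation action of `R(X, Y)` on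
`T`. If `∇∇C = α ⊗ C`, then `C` at each point is an eigenvector of that action, with eigenvalue
`α(Y, X) - α(X, Y)`.

Since the connection is h-metrical, `R(X, Y)` is `g`-skew (`curvMat_skew`), so its action on tensors
is skew for the induced positive definite inner product and has no non-zero real eigenvalue
(`eq_zero_of_tensorAct_eq_mul`). Thus `α` is symmetric where `C ≠ 0`, and on the closure by
continuity. Also `R(X, Y) C = 0` everywhere, trivially so at zeros of `C`. Lowering an index by `g`
commutes with a skew action, and `𝐑 - 𝐂` is a function times a polynomial in `g`, which skew
endomorphisms annihilate; this gives the statements for `𝐂` and `𝐑`.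

The recurrent case reduces to this one with `α = ∇A + A ⊗ A`, whose second summand is symmetric. -/

/-- The horizontal vector `δ_j` at a point, in coordinates. -/
noncomputable def hVec {n : ℕ} (ℓ : Coord n → ℝ) (j : Fin n) (p : Coord n) : Coord n :=
  (stdVec j, -∑ r, nonlin ℓ r j p • stdVec r)

lemma hder_eq_fderiv {n : ℕ} (ℓ : Coord n → ℝ) (j : Fin n) (f : Coord n → ℝ) (p : Coord n) :
    hder ℓ j f p = fderiv ℝ f p (hVec ℓ j p) := by
  have h : hVec ℓ j p = (stdVec j, 0) - ∑ r, nonlin ℓ r j p • ((0, stdVec r) : Coord n) := by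
    ext1
    · simp [hVec, Prod.fst_sum]
    · simp [hVec, Prod.snd_sum]
  rw [h]
  simp only [hder, dx, dy, map_sub, map_sum, map_smul, smul_eq_mul]

/-! ### Calculus of horizontal derivatives. -/

section Calculus

variable {n : ℕ} {ℓ f g : Coord n → ℝ} {U : Set (Coord n)} {p : Coord n}

lemma contDiffOn_fderiv_apply (hU : IsOpen U) (hf : ContDiffOn ℝ ∞ f U) (v : Coord n) :
    ContDiffOn ℝ ∞ (fun q => fderiv ℝ f q v) U :=
  (hf.fderiv_of_isOpen (m := ∞) hU (by simp)).clm_apply contDiffOn_const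

lemma contDiffOn_dx (hU : IsOpen U) (hf : ContDiffOn ℝ ∞ f U) (i : Fin n) :
    ContDiffOn ℝ ∞ (dx i f) U := contDiffOn_fderiv_apply hU hf _

lemma contDiffOn_dy (hU : IsOpen U) (hf : ContDiffOn ℝ ∞ f U) (i : Fin n) :
    ContDiffOn ℝ ∞ (dy i f) U := contDiffOn_fderiv_apply hU hf _

lemma differentiableAt_of_smooth (hU : IsOpen U) (hf : ContDiffOn ℝ ∞ f U) (hp : p ∈ U) :
    DifferentiableAt ℝ f p :=
  (hf.contDiffAt (hU.mem_nhds hp)).differentiableAt (by simp)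

lemma dy_comm (hU : IsOpen U) (hf : ContDiffOn ℝ ∞ f U) (hp : p ∈ U) (i j : Fin n) :
    dy i (dy j f) p = dy j (dy i f) p := by
  have hs : IsSymmSndFDerivAt ℝ f p :=
    (hf.contDiffAt (hU.mem_nhds hp)).isSymmSndFDerivAt (by
      rw [minSmoothness_of_isRCLikeNormedField]; exact WithTop.coe_le_coe.2 (le_top : (2 : ℕ∞) ≤ ⊤))
  have hd : DifferentiableAt ℝ (fderiv ℝ f) p :=
    ((hf.fderiv_of_isOpen (m := ∞) hU (by simp)).contDiffAt
      (hU.mem_nhds hp)).differentiableAt (by simp)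
  have key (v w : Coord n) :
      fderiv ℝ (fun q => fderiv ℝ f q v) p w = fderiv ℝ (fderiv ℝ f) p w v := by
    rw [fderiv_clm_apply hd (differentiableAt_const v)]
    simp
  change fderiv ℝ (fun q => fderiv ℝ f q _) p _ = fderiv ℝ (fun q => fderiv ℝ f q _) p _
  rw [key, key]
  exact hs.eq _ _

lemma hder_add (hf : DifferentiableAt ℝ f p) (hg : DifferentiableAt ℝ g p) (a : Fin n) :
    hder ℓ a (fun q => f q + g q) p = hder ℓ a f p + hder ℓ a g p := by
  simp only [hder_eq_fderiv]; rw [fderiv_fun_add hf hg]; simp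

lemma hder_sub (hf : DifferentiableAt ℝ f p) (hg : DifferentiableAt ℝ g p) (a : Fin n) :
    hder ℓ a (fun q => f q - g q) p = hder ℓ a f p - hder ℓ a g p := by
  simp only [hder_eq_fderiv]; rw [fderiv_fun_sub hf hg]; simp

lemma hder_mul (hf : DifferentiableAt ℝ f p) (hg : DifferentiableAt ℝ g p) (a : Fin n) :
    hder ℓ a (fun q => f q * g q) p = hder ℓ a f p * g p + f p * hder ℓ a g p := by
  simp only [hder_eq_fderiv]; rw [fderiv_fun_mul hf hg]; simp; ring

lemma hder_sum {ι : Type*} {s : Finset ι} {F : ι → Coord n → ℝ}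
    (hF : ∀ i, DifferentiableAt ℝ (F i) p) (a : Fin n) :
    hder ℓ a (fun q => ∑ i ∈ s, F i q) p = ∑ i ∈ s, hder ℓ a (F i) p := by
  simp only [hder_eq_fderiv]; rw [fderiv_fun_sum fun i _ => hF i]; simp

lemma hder_congr (hU : IsOpen U) (hp : p ∈ U) (h : ∀ q ∈ U, f q = g q) (a : Fin n) :
    hder ℓ a f p = hder ℓ a g p := by
  have : f =ᶠ[nhds p] g := Filter.eventually_of_mem (hU.mem_nhds hp) h
  simp only [hder_eq_fderiv]; rw [this.fderiv_eq]

lemma contDiffOn_hder (hU : IsOpen U) (hN : ∀ i j, ContDiffOn ℝ ∞ (nonlin ℓ i j) U)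
    (hf : ContDiffOn ℝ ∞ f U) (a : Fin n) : ContDiffOn ℝ ∞ (hder ℓ a f) U :=
  (contDiffOn_dx hU hf a).sub
    (ContDiffOn.sum fun r _ => (hN r a).mul (contDiffOn_dy hU hf r))

/-- The commutator of horizontal derivatives is the vertical field `hBracket`. -/
lemma hder_hder_sub_hder_hder (hU : IsOpen U) (hN : ∀ i j, ContDiffOn ℝ ∞ (nonlin ℓ i j) U)
    (hf : ContDiffOn ℝ ∞ f U) (hp : p ∈ U) (a b : Fin n) :
    hder ℓ a (hder ℓ b f) p - hder ℓ b (hder ℓ a f) p =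
      ∑ r, hBracket ℓ r a b p * dy r f p := by
  have hs : IsSymmSndFDerivAt ℝ f p :=
    (hf.contDiffAt (hU.mem_nhds hp)).isSymmSndFDerivAt (by
      rw [minSmoothness_of_isRCLikeNormedField]; exact WithTop.coe_le_coe.2 (le_top : (2 : ℕ∞) ≤ ⊤))
  have hd : DifferentiableAt ℝ (fderiv ℝ f) p :=
    ((hf.fderiv_of_isOpen (m := ∞) hU (by simp)).contDiffAt
      (hU.mem_nhds hp)).differentiableAt (by simp)
  have hNd (i j) : DifferentiableAt ℝ (nonlin ℓ i j) p :=
    differentiableAt_of_smooth hU (hN i j) hp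
  have hv (b : Fin n) : HasFDerivAt (hVec ℓ b)
      ((0 : Coord n →L[ℝ] EuclideanSpace ℝ (Fin n)).prod
        (-∑ r, (fderiv ℝ (nonlin ℓ r b) p).smulRight (stdVec r))) p :=
    (hasFDerivAt_const _ _).prodMk
      (HasFDerivAt.fun_sum fun r _ => (hNd r b).hasFDerivAt.smul_const (stdVec r)).neg
  -- The Hessian term is symmetric in the two directions; only the derivative of the field `hVec ℓ
  -- b` itself survives antisymmetrization.
  have key (a b : Fin n) : hder ℓ a (hder ℓ b f) p =
      fderiv ℝ (fderiv ℝ f) p (hVec ℓ a p) (hVec ℓ b p)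
        - ∑ r, hder ℓ a (nonlin ℓ r b) p * dy r f p := by
    have h1 : hder ℓ b f = fun q => fderiv ℝ f q (hVec ℓ b q) :=
      funext fun q => hder_eq_fderiv ℓ b f q
    have h2 : ((0 : EuclideanSpace ℝ (Fin n)), -∑ r, hder ℓ a (nonlin ℓ r b) p • stdVec r) =
        -∑ r, hder ℓ a (nonlin ℓ r b) p • ((0, stdVec r) : Coord n) := by
      ext1
      · simp [Prod.fst_sum]
      · simp [Prod.snd_sum]
    rw [hder_eq_fderiv, h1, fderiv_clm_apply hd (hv b).differentiableAt, (hv b).fderiv]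
    have h3 : ((0 : Coord n →L[ℝ] EuclideanSpace ℝ (Fin n)).prod
        (-∑ r, (fderiv ℝ (nonlin ℓ r b) p).smulRight (stdVec r))) (hVec ℓ a p) =
        (0, -∑ r, hder ℓ a (nonlin ℓ r b) p • stdVec r) := by
      simp [hder_eq_fderiv]
    simp only [add_apply, ContinuousLinearMap.comp_apply,
      ContinuousLinearMap.flip_apply, h3, h2]
    simp only [map_neg, map_sum, map_smul, smul_eq_mul, dy]
    ring
  rw [key a b, key b a, hs.eq (hVec ℓ a p) (hVec ℓ b p)]
  simp only [hBracket, sub_mul, Finset.sum_sub_distrib]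
  ring

end Calculus

/-! ### Smoothness of the inverse of a matrix of functions. -/

section MatrixEntries

variable {E : Type*} [NormedAddCommGroup E] [NormedSpace ℝ E] {U : Set E} {n : ℕ}

lemma contDiffOn_det {A : E → Matrix (Fin n) (Fin n) ℝ}
    (hA : ∀ i j, ContDiffOn ℝ ∞ (fun q => A q i j) U) :
    ContDiffOn ℝ ∞ (fun q => (A q).det) U := by
  simp only [Matrix.det_apply']
  exact ContDiffOn.sum fun σ _ => contDiffOn_const.mul (contDiffOn_prod fun i _ => hA _ _)

/-- Cramer's rule: the entries are quotients of determinants. -/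
lemma contDiffOn_matrix_inv {A : E → Matrix (Fin n) (Fin n) ℝ}
    (hA : ∀ i j, ContDiffOn ℝ ∞ (fun q => A q i j) U) (hdet : ∀ q ∈ U, (A q).det ≠ 0)
    (i j : Fin n) : ContDiffOn ℝ ∞ (fun q => (A q)⁻¹ i j) U := by
  simp only [Matrix.inv_def, Ring.inverse_eq_inv', Matrix.smul_apply, smul_eq_mul,
    Matrix.adjugate_apply]
  refine ((contDiffOn_det hA).inv hdet).mul (contDiffOn_det fun k l => ?_)
  simp only [Matrix.updateRow_apply]
  split_ifs
  · exact contDiffOn_const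
  · exact hA k l

end MatrixEntries

/-! ### Derivation action of endomorphisms on tensors. -/

section Algebra

variable {n k : ℕ}

/-- The natural action of an endomorphism on the arguments of a form. -/
def argAct (Φ : Matrix (Fin n) (Fin n) ℝ) (θ : (Fin k → Fin n) → ℝ) (J : Fin k → Fin n) : ℝ :=
  ∑ s : Fin k, ∑ m, Φ m (J s) * θ (Function.update J s m)

/-- The action of an endomorphism as a derivation on vector-valued tensors. -/
def tensorAct (Φ : Matrix (Fin n) (Fin n) ℝ) (T : Fin n → (Fin k → Fin n) → ℝ)
    (i : Fin n) (J : Fin k → Fin n) : ℝ :=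
  ∑ m, Φ i m * T m J - argAct Φ (T i) J

/-- Actions on two different slots commute and cancel. On a single slot they compose in reverse
order, as for any substitution into arguments, hence `Ψ * Φ - Φ * Ψ`. -/
lemma argAct_argAct (Φ Ψ : Matrix (Fin n) (Fin n) ℝ) (θ : (Fin k → Fin n) → ℝ)
    (J : Fin k → Fin n) :
    argAct Φ (argAct Ψ θ) J - argAct Ψ (argAct Φ θ) J = argAct (Ψ * Φ - Φ * Ψ) θ J := by
  have slot (Φ Ψ : Matrix (Fin n) (Fin n) ℝ) (s t : Fin k) (hst : s ≠ t) :
      ∑ m, Φ m (J s) * ∑ l, Ψ l (Function.update J s m t) *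
        θ (Function.update (Function.update J s m) t l) =
      ∑ m, ∑ l, Φ m (J s) * Ψ l (J t) * θ (Function.update (Function.update J s m) t l) := by
    simp only [Function.update_of_ne hst.symm, Finset.mul_sum, mul_assoc]
  have slot' (Φ Ψ : Matrix (Fin n) (Fin n) ℝ) (s : Fin k) :
      ∑ m, Φ m (J s) * ∑ l, Ψ l (Function.update J s m s) *
        θ (Function.update (Function.update J s m) s l) =
      ∑ l, (Ψ * Φ) l (J s) * θ (Function.update J s l) := by
    simp only [Function.update_self, Function.update_idem, Finset.mul_sum, Matrix.mul_apply,
      Finset.sum_mul]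
    rw [Finset.sum_comm]
    exact Finset.sum_congr rfl fun l _ => Finset.sum_congr rfl fun m _ => by ring
  have expand (Φ Ψ : Matrix (Fin n) (Fin n) ℝ) : argAct Φ (argAct Ψ θ) J =
      ∑ s : Fin k, ∑ t : Fin k, ∑ m, Φ m (J s) * ∑ l, Ψ l (Function.update J s m t) *
        θ (Function.update (Function.update J s m) t l) := by
    unfold argAct
    refine Finset.sum_congr rfl fun s _ => ?_
    rw [Finset.sum_comm]
    exact Finset.sum_congr rfl fun m _ => by rw [Finset.mul_sum]
  rw [expand, expand, Finset.sum_comm (f := fun s t => ∑ m, Ψ m (J s) * _),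
    ← Finset.sum_sub_distrib]
  unfold argAct
  refine Finset.sum_congr rfl fun s _ => ?_
  rw [← Finset.sum_sub_distrib, Finset.sum_eq_single s]
  · rw [slot', slot', ← Finset.sum_sub_distrib]
    exact Finset.sum_congr rfl fun l _ => by rw [Matrix.sub_apply, sub_mul]
  · intro t _ hts
    rw [slot _ _ _ _ hts.symm, slot _ _ _ _ hts, Finset.sum_comm, sub_eq_zero]
    refine Finset.sum_congr rfl fun l _ => Finset.sum_congr rfl fun m _ => ?_
    rw [Function.update_comm hts.symm, mul_comm (Φ _ _)]
  · simp

lemma argAct_sub (Φ Ψ : Matrix (Fin n) (Fin n) ℝ) (θ : (Fin k → Fin n) → ℝ)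
    (J : Fin k → Fin n) : argAct (Φ - Ψ) θ J = argAct Φ θ J - argAct Ψ θ J := by
  simp only [argAct, Matrix.sub_apply, sub_mul, Finset.sum_sub_distrib]

lemma argAct_add (Φ Ψ : Matrix (Fin n) (Fin n) ℝ) (θ : (Fin k → Fin n) → ℝ)
    (J : Fin k → Fin n) : argAct (Φ + Ψ) θ J = argAct Φ θ J + argAct Ψ θ J := by
  simp only [argAct, Matrix.add_apply, add_mul, Finset.sum_add_distrib]

lemma argAct_fun_sub (Φ : Matrix (Fin n) (Fin n) ℝ) (θ η : (Fin k → Fin n) → ℝ)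
    (J : Fin k → Fin n) : argAct Φ (fun I => θ I - η I) J = argAct Φ θ J - argAct Φ η J := by
  simp only [argAct, mul_sub, Finset.sum_sub_distrib]

lemma argAct_fun_add (Φ : Matrix (Fin n) (Fin n) ℝ) (θ η : (Fin k → Fin n) → ℝ)
    (J : Fin k → Fin n) : argAct Φ (fun I => θ I + η I) J = argAct Φ θ J + argAct Φ η J := by
  simp only [argAct, mul_add, Finset.sum_add_distrib]

lemma argAct_fun_mul (Φ : Matrix (Fin n) (Fin n) ℝ) (c : ℝ) (θ : (Fin k → Fin n) → ℝ)
    (J : Fin k → Fin n) : argAct Φ (fun I => c * θ I) J = c * argAct Φ θ J := by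
  simp only [argAct, Finset.mul_sum, mul_left_comm]

lemma argAct_fun_sum {ι : Type*} [Fintype ι] (Φ : Matrix (Fin n) (Fin n) ℝ)
    (θ : ι → (Fin k → Fin n) → ℝ) (J : Fin k → Fin n) :
    argAct Φ (fun I => ∑ a, θ a I) J = ∑ a, argAct Φ (θ a) J := by
  simp only [argAct, Finset.mul_sum]
  rw [Finset.sum_comm (s := Finset.univ (α := ι))]
  exact Finset.sum_congr rfl fun s _ => Finset.sum_comm

lemma tensorAct_add (Φ Ψ : Matrix (Fin n) (Fin n) ℝ) (T : Fin n → (Fin k → Fin n) → ℝ)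
    (i : Fin n) (J : Fin k → Fin n) :
    tensorAct (Φ + Ψ) T i J = tensorAct Φ T i J + tensorAct Ψ T i J := by
  simp only [tensorAct, argAct_add, Matrix.add_apply, add_mul, Finset.sum_add_distrib]
  ring

lemma tensorAct_sub (Φ Ψ : Matrix (Fin n) (Fin n) ℝ) (T : Fin n → (Fin k → Fin n) → ℝ)
    (i : Fin n) (J : Fin k → Fin n) :
    tensorAct (Φ - Ψ) T i J = tensorAct Φ T i J - tensorAct Ψ T i J := by
  simp only [tensorAct, argAct_sub, Matrix.sub_apply, sub_mul, Finset.sum_sub_distrib]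
  ring

lemma tensorAct_fun_add (Φ : Matrix (Fin n) (Fin n) ℝ) (S T : Fin n → (Fin k → Fin n) → ℝ)
    (i : Fin n) (J : Fin k → Fin n) :
    tensorAct Φ (fun i J => S i J + T i J) i J = tensorAct Φ S i J + tensorAct Φ T i J := by
  simp only [tensorAct, argAct_fun_add, mul_add, Finset.sum_add_distrib]
  ring

/-- The mixed terms, one factor on the upper index and one on the arguments, are symmetric in `Φ`
and `Ψ`. The reversed commutator on the arguments is corrected by the minus sign in `tensorAct`. -/
lemma tensorAct_tensorAct (Φ Ψ : Matrix (Fin n) (Fin n) ℝ) (T : Fin n → (Fin k → Fin n) → ℝ)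
    (i : Fin n) (J : Fin k → Fin n) :
    tensorAct Φ (tensorAct Ψ T) i J - tensorAct Ψ (tensorAct Φ T) i J =
      tensorAct (Φ * Ψ - Ψ * Φ) T i J := by
  have expand (Φ Ψ : Matrix (Fin n) (Fin n) ℝ) : tensorAct Φ (tensorAct Ψ T) i J =
      ∑ m, (Φ * Ψ) i m * T m J - ∑ m, Φ i m * argAct Ψ (T m) J
        - (∑ m, Ψ i m * argAct Φ (T m) J - argAct Φ (argAct Ψ (T i)) J) := by
    have h1 : ∑ m, Φ i m * ∑ l, Ψ m l * T l J = ∑ m, (Φ * Ψ) i m * T m J := by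
      simp only [Finset.mul_sum, Matrix.mul_apply, Finset.sum_mul]
      rw [Finset.sum_comm]
      simp only [mul_assoc]
    have h2 : argAct Φ (tensorAct Ψ T i) J =
        ∑ m, Ψ i m * argAct Φ (T m) J - argAct Φ (argAct Ψ (T i)) J := by
      have : tensorAct Ψ T i = fun I => (∑ m, Ψ i m * T m I) - argAct Ψ (T i) I := rfl
      rw [this, argAct_fun_sub, argAct_fun_sum]
      simp only [argAct_fun_mul]
    rw [tensorAct, h2, ← h1]
    simp only [tensorAct, mul_sub, Finset.sum_sub_distrib]
  have h := argAct_argAct Φ Ψ (T i) J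
  rw [expand, expand, tensorAct, argAct_sub]
  rw [argAct_sub] at h
  simp only [Matrix.sub_apply, sub_mul, Finset.sum_sub_distrib]
  linarith

end Algebra

/-! ### Local Finsler structures: smoothness, metricity, skewness of the curvature. -/

/-- `ℓ` is the coordinate expression of a Finsler structure on the open set `U`. -/
structure IsLocalFinsler {n : ℕ} (ℓ : Coord n → ℝ) (U : Set (Coord n)) : Prop where
  isOpen : IsOpen U
  smooth : ContDiffOn ℝ ∞ ℓ U
  posDef : ∀ p ∈ U, (Matrix.of fun i j => metric ℓ i j p).PosDef

/-- The matrix of the metric. -/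
noncomputable def gMat {n : ℕ} (ℓ : Coord n → ℝ) (p : Coord n) : Matrix (Fin n) (Fin n) ℝ :=
  Matrix.of fun i j => metric ℓ i j p

/-- The connection matrix `(F_a)ⁱ_m = Fⁱ_ma` of the direction `δ_a`. -/
noncomputable def fMat {n : ℕ} (ℓ : Coord n → ℝ) (a : Fin n) (p : Coord n) :
    Matrix (Fin n) (Fin n) ℝ :=
  Matrix.of fun i m => hCoeff ℓ i m a p

/-- The matrix of the curvature endomorphism `R(∂_a, ∂_b)`. -/
noncomputable def curvMat {n : ℕ} (ℓ : Coord n → ℝ) (a b : Fin n) (p : Coord n) :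
    Matrix (Fin n) (Fin n) ℝ :=
  Matrix.of fun i h => curv ℓ i a b h p

/-- The entrywise horizontal derivative of a matrix of functions. -/
noncomputable def hderMat {n : ℕ} (ℓ : Coord n → ℝ) (a : Fin n)
    (A : Coord n → Matrix (Fin n) (Fin n) ℝ) (p : Coord n) : Matrix (Fin n) (Fin n) ℝ :=
  Matrix.of fun i j => hder ℓ a (fun q => A q i j) p

section HderMat

variable {n : ℕ} {ℓ : Coord n → ℝ} {A B : Coord n → Matrix (Fin n) (Fin n) ℝ} {p : Coord n}

lemma hderMat_mul (hA : ∀ i j, DifferentiableAt ℝ (fun q => A q i j) p)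
    (hB : ∀ i j, DifferentiableAt ℝ (fun q => B q i j) p) (a : Fin n) :
    hderMat ℓ a (fun q => A q * B q) p = hderMat ℓ a A p * B p + A p * hderMat ℓ a B p := by
  ext i j
  simp only [hderMat, Matrix.of_apply, Matrix.add_apply, Matrix.mul_apply]
  rw [hder_sum fun m => (hA i m).fun_mul (hB m j), ← Finset.sum_add_distrib]
  exact Finset.sum_congr rfl fun m _ => hder_mul (hA i m) (hB m j) a

lemma hderMat_add (hA : ∀ i j, DifferentiableAt ℝ (fun q => A q i j) p)
    (hB : ∀ i j, DifferentiableAt ℝ (fun q => B q i j) p) (a : Fin n) :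
    hderMat ℓ a (fun q => A q + B q) p = hderMat ℓ a A p + hderMat ℓ a B p := by
  ext i j
  exact hder_add (hA i j) (hB i j) a

lemma differentiableAt_mul_apply (hA : ∀ i j, DifferentiableAt ℝ (fun q => A q i j) p)
    (hB : ∀ i j, DifferentiableAt ℝ (fun q => B q i j) p) (i j : Fin n) :
    DifferentiableAt ℝ (fun q => (A q * B q) i j) p := by
  simp only [Matrix.mul_apply]
  exact DifferentiableAt.fun_sum fun m _ => (hA i m).fun_mul (hB m j)

end HderMat

namespace IsLocalFinsler

variable {n : ℕ} {ℓ : Coord n → ℝ} {U : Set (Coord n)} {p : Coord n}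

lemma contDiffOn_sq (h : IsLocalFinsler ℓ U) : ContDiffOn ℝ ∞ (fun q => ℓ q ^ 2) U :=
  h.smooth.pow 2

lemma contDiffOn_metric (h : IsLocalFinsler ℓ U) (i j : Fin n) :
    ContDiffOn ℝ ∞ (metric ℓ i j) U :=
  contDiffOn_const.mul (contDiffOn_dy h.isOpen (contDiffOn_dy h.isOpen h.contDiffOn_sq j) i)

lemma metric_comm (h : IsLocalFinsler ℓ U) (hp : p ∈ U) (i j : Fin n) :
    metric ℓ i j p = metric ℓ j i p := by
  rw [metric, metric, dy_comm h.isOpen h.contDiffOn_sq hp]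

lemma det_gMat_ne_zero (h : IsLocalFinsler ℓ U) (hp : p ∈ U) : (gMat ℓ p).det ≠ 0 :=
  (h.posDef p hp).det_pos.ne'

lemma contDiffOn_metricInv (h : IsLocalFinsler ℓ U) (i j : Fin n) :
    ContDiffOn ℝ ∞ (metricInv ℓ i j) U :=
  contDiffOn_matrix_inv (A := gMat ℓ) h.contDiffOn_metric (fun _ hq => h.det_gMat_ne_zero hq) i j

lemma contDiffOn_spray (h : IsLocalFinsler ℓ U) (i : Fin n) : ContDiffOn ℝ ∞ (spray ℓ i) U := by
  have hy (k : Fin n) : ContDiffOn ℝ ∞ (fun p : Coord n => p.2 k) U :=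
    ((EuclideanSpace.proj (𝕜 := ℝ) k).contDiff.comp contDiff_snd).contDiffOn
  exact contDiffOn_const.mul <| ContDiffOn.sum fun r _ => (h.contDiffOn_metricInv i r).mul <|
    (ContDiffOn.sum fun k _ => (hy k).mul
      (contDiffOn_dx h.isOpen (contDiffOn_dy h.isOpen h.contDiffOn_sq r) k)).sub
      (contDiffOn_dx h.isOpen h.contDiffOn_sq r)

lemma contDiffOn_nonlin (h : IsLocalFinsler ℓ U) (i j : Fin n) :
    ContDiffOn ℝ ∞ (nonlin ℓ i j) U :=
  contDiffOn_dy h.isOpen (h.contDiffOn_spray i) j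

lemma contDiffOn_hder (h : IsLocalFinsler ℓ U) {f : Coord n → ℝ} (hf : ContDiffOn ℝ ∞ f U)
    (a : Fin n) : ContDiffOn ℝ ∞ (hder ℓ a f) U :=
  FinslerGeom.contDiffOn_hder h.isOpen h.contDiffOn_nonlin hf a

lemma contDiffOn_hCoeff (h : IsLocalFinsler ℓ U) (i j k : Fin n) :
    ContDiffOn ℝ ∞ (hCoeff ℓ i j k) U :=
  contDiffOn_const.mul <| ContDiffOn.sum fun r _ => (h.contDiffOn_metricInv i r).mul <|
    ((h.contDiffOn_hder (h.contDiffOn_metric r k) j).add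
      (h.contDiffOn_hder (h.contDiffOn_metric r j) k)).sub
      (h.contDiffOn_hder (h.contDiffOn_metric j k) r)

lemma contDiffOn_vCoeff (h : IsLocalFinsler ℓ U) (i j k : Fin n) :
    ContDiffOn ℝ ∞ (vCoeff ℓ i j k) U :=
  contDiffOn_const.mul <| ContDiffOn.sum fun r _ => (h.contDiffOn_metricInv i r).mul <|
    contDiffOn_dy h.isOpen (h.contDiffOn_metric j k) r

lemma contDiffOn_curv (h : IsLocalFinsler ℓ U) (i j k l : Fin n) :
    ContDiffOn ℝ ∞ (curv ℓ i j k l) U :=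
  (((h.contDiffOn_hder (h.contDiffOn_hCoeff _ _ _) _).sub
    (h.contDiffOn_hder (h.contDiffOn_hCoeff _ _ _) _)).add <|
    ContDiffOn.sum fun _ _ => ((h.contDiffOn_hCoeff _ _ _).mul (h.contDiffOn_hCoeff _ _ _)).sub
      ((h.contDiffOn_hCoeff _ _ _).mul (h.contDiffOn_hCoeff _ _ _))).add <|
    ContDiffOn.sum fun _ _ => ((h.contDiffOn_hder (h.contDiffOn_nonlin _ _) _).sub
      (h.contDiffOn_hder (h.contDiffOn_nonlin _ _) _)).mul (h.contDiffOn_vCoeff _ _ _)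

lemma contDiffOn_scalarCurv (h : IsLocalFinsler ℓ U) : ContDiffOn ℝ ∞ (scalarCurv ℓ) U :=
  ContDiffOn.sum fun _ _ => ContDiffOn.sum fun _ _ => (h.contDiffOn_metricInv _ _).mul <|
    ContDiffOn.sum fun _ _ => h.contDiffOn_curv _ _ _ _

lemma contDiffOn_concirc (h : IsLocalFinsler ℓ U) (i j k l : Fin n) :
    ContDiffOn ℝ ∞ (concirc ℓ i j k l) U :=
  (h.contDiffOn_curv _ _ _ _).sub <| (h.contDiffOn_scalarCurv.div_const _).mul <|
    ((h.contDiffOn_metric _ _).mul contDiffOn_const).sub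
      ((h.contDiffOn_metric _ _).mul contDiffOn_const)

lemma differentiableAt (h : IsLocalFinsler ℓ U) {f : Coord n → ℝ} (hf : ContDiffOn ℝ ∞ f U)
    (hp : p ∈ U) : DifferentiableAt ℝ f p :=
  differentiableAt_of_smooth h.isOpen hf hp

lemma hder_comm (h : IsLocalFinsler ℓ U) (hI : ∀ p ∈ U, ∀ i j k, hBracket ℓ i j k p = 0)
    {f : Coord n → ℝ} (hf : ContDiffOn ℝ ∞ f U) (hp : p ∈ U) (a b : Fin n) :
    hder ℓ a (hder ℓ b f) p = hder ℓ b (hder ℓ a f) p := by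
  have := hder_hder_sub_hder_hder h.isOpen h.contDiffOn_nonlin hf hp a b
  simpa [hI p hp, sub_eq_zero] using this

lemma hder_metric_comm (h : IsLocalFinsler ℓ U) (hp : p ∈ U) (a i j : Fin n) :
    hder ℓ a (metric ℓ i j) p = hder ℓ a (metric ℓ j i) p :=
  hder_congr h.isOpen hp (fun _ hq => h.metric_comm hq i j) a

/-- Absence of horizontal torsion, which removes the first-order term from the Ricci identity. -/
lemma hCoeff_comm (h : IsLocalFinsler ℓ U) (hp : p ∈ U) (i j k : Fin n) :
    hCoeff ℓ i j k p = hCoeff ℓ i k j p := by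
  rw [hCoeff, hCoeff]
  congr 1
  refine Finset.sum_congr rfl fun r _ => ?_
  rw [h.hder_metric_comm hp r j k]
  ring

/-- Multiplying by `g` cancels the inverse metric in `hCoeff` and leaves the Christoffel symbols of
the first kind. -/
lemma gMat_mul_fMat (h : IsLocalFinsler ℓ U) (hp : p ∈ U) (i j k : Fin n) :
    (gMat ℓ p * fMat ℓ k p) i j = (1 / 2) * (hder ℓ j (metric ℓ i k) p
      + hder ℓ k (metric ℓ i j) p - hder ℓ i (metric ℓ j k) p) := by
  let v : Fin n → ℝ := fun r => (1 / 2) * (hder ℓ j (metric ℓ r k) p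
      + hder ℓ k (metric ℓ r j) p - hder ℓ r (metric ℓ j k) p)
  have hF : (fun m => fMat ℓ k p m j) = Matrix.mulVec (gMat ℓ p)⁻¹ v := by
    ext m
    simp only [fMat, Matrix.of_apply, hCoeff, Matrix.mulVec, dotProduct, v, Finset.mul_sum]
    exact Finset.sum_congr rfl fun r _ => by simp only [metricInv, gMat]; ring
  have : (gMat ℓ p * fMat ℓ k p) i j = Matrix.mulVec (gMat ℓ p) (fun m => fMat ℓ k p m j) i := rfl
  rw [this, hF, Matrix.mulVec_mulVec,
    Matrix.mul_nonsing_inv _ (h.det_gMat_ne_zero hp).isUnit, Matrix.one_mulVec]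

/-- The Cartan connection is `h`-metrical. -/
lemma hderMat_gMat (h : IsLocalFinsler ℓ U) (hp : p ∈ U) (a : Fin n) :
    hderMat ℓ a (gMat ℓ) p = (fMat ℓ a p).transpose * gMat ℓ p + gMat ℓ p * fMat ℓ a p := by
  have hg : (gMat ℓ p).transpose = gMat ℓ p := by
    ext i j; exact h.metric_comm hp j i
  have ht : (fMat ℓ a p).transpose * gMat ℓ p = (gMat ℓ p * fMat ℓ a p).transpose := by
    rw [Matrix.transpose_mul, hg]
  ext i j
  rw [ht, Matrix.add_apply, Matrix.transpose_apply, h.gMat_mul_fMat hp, h.gMat_mul_fMat hp,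
    h.hder_metric_comm hp a j i]
  simp only [hderMat, gMat, Matrix.of_apply]
  ring

/-- Integrability removes the vertical term of `curv`; what remains is `-(δ_a F_b - δ_b F_a + [F_a,
F_b])`. -/
lemma curvMat_eq (hI : ∀ p ∈ U, ∀ i j k, hBracket ℓ i j k p = 0) (hp : p ∈ U) (a b : Fin n) :
    curvMat ℓ a b p = hderMat ℓ b (fMat ℓ a) p - hderMat ℓ a (fMat ℓ b) p
      + (fMat ℓ b p * fMat ℓ a p - fMat ℓ a p * fMat ℓ b p) := by
  ext i k
  simp only [curvMat, Matrix.of_apply, curv, hI p hp, hderMat, fMat, Matrix.add_apply,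
    Matrix.sub_apply, Matrix.mul_apply, zero_mul, Finset.sum_const_zero, add_zero,
    Finset.sum_sub_distrib, mul_comm (hCoeff ℓ _ k _ p)]

lemma differentiableAt_fMat (h : IsLocalFinsler ℓ U) (hp : p ∈ U) (a i j : Fin n) :
    DifferentiableAt ℝ (fun q => fMat ℓ a q i j) p :=
  h.differentiableAt (h.contDiffOn_hCoeff i j a) hp

lemma differentiableAt_gMat (h : IsLocalFinsler ℓ U) (hp : p ∈ U) (i j : Fin n) :
    DifferentiableAt ℝ (fun q => gMat ℓ q i j) p :=
  h.differentiableAt (h.contDiffOn_metric i j) hp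

/-- The curvature endomorphisms are skew for the metric. -/
lemma curvMat_skew (h : IsLocalFinsler ℓ U) (hI : ∀ p ∈ U, ∀ i j k, hBracket ℓ i j k p = 0)
    (hp : p ∈ U) (a b : Fin n) :
    (curvMat ℓ a b p).transpose * gMat ℓ p + gMat ℓ p * curvMat ℓ a b p = 0 := by
  -- Differentiate the metricity identity once more; since `δ_a` and `δ_b` commute on the entries of
  -- `g`, the two orders must agree.
  have second (a b : Fin n) : hderMat ℓ a (hderMat ℓ b (gMat ℓ)) p =
      (hderMat ℓ a (fMat ℓ b) p).transpose * gMat ℓ p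
      + (fMat ℓ b p).transpose * ((fMat ℓ a p).transpose * gMat ℓ p + gMat ℓ p * fMat ℓ a p)
      + (((fMat ℓ a p).transpose * gMat ℓ p + gMat ℓ p * fMat ℓ a p) * fMat ℓ b p
      + gMat ℓ p * hderMat ℓ a (fMat ℓ b) p) := by
    have h1 : hderMat ℓ a (hderMat ℓ b (gMat ℓ)) p = hderMat ℓ a (fun q =>
        (fMat ℓ b q).transpose * gMat ℓ q + gMat ℓ q * fMat ℓ b q) p := by
      ext i j
      exact hder_congr h.isOpen hp (fun q hq => by rw [h.hderMat_gMat hq]) a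
    have hF := h.differentiableAt_fMat hp b
    have hg := h.differentiableAt_gMat hp
    have hFt : ∀ i j, DifferentiableAt ℝ (fun q => (fMat ℓ b q).transpose i j) p :=
      fun i j => hF j i
    rw [h1, hderMat_add (differentiableAt_mul_apply hFt hg) (differentiableAt_mul_apply hg hF),
      hderMat_mul hFt hg, hderMat_mul hg hF, h.hderMat_gMat hp]
    rfl
  have comm : hderMat ℓ a (hderMat ℓ b (gMat ℓ)) p = hderMat ℓ b (hderMat ℓ a (gMat ℓ)) p := by
    ext i j
    exact h.hder_comm hI (h.contDiffOn_metric i j) hp a b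
  rw [second, second] at comm
  rw [curvMat_eq hI hp]
  simp only [Matrix.transpose_add, Matrix.transpose_sub, Matrix.transpose_mul]
  rw [← sub_eq_zero] at comm
  -- The negation comes from the sign convention for `R`.
  rw [← neg_eq_zero, ← comm]
  noncomm_ring

end IsLocalFinsler

/-! ### The h-covariant derivative and its Ricci identity. -/

section Covariant

variable {n k : ℕ} {ℓ : Coord n → ℝ} {U : Set (Coord n)} {p : Coord n}

/-- The h-covariant derivative of a vector-valued tensor in the direction `δ_a`. -/
noncomputable def covDir (ℓ : Coord n → ℝ) (a : Fin n)
    (T : Fin n → (Fin k → Fin n) → Coord n → ℝ)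
    (i : Fin n) (J : Fin k → Fin n) (p : Coord n) : ℝ :=
  hder ℓ a (T i J) p + tensorAct (fMat ℓ a p) (fun i J => T i J p) i J

lemma hCovVec_cons (T : Fin n → (Fin k → Fin n) → Coord n → ℝ) (i a : Fin n)
    (J : Fin k → Fin n) : hCovVec ℓ T i (Fin.cons a J) = covDir ℓ a T i J := by
  ext p
  simp [hCovVec, covDir, tensorAct, argAct, fMat, add_sub_assoc]

/-- The inner direction `b` is itself an argument of `∇T`, so the outer derivative also corrects
that slot; this is the subtracted sum. -/
lemma hCovVec_hCovVec_cons (T : Fin n → (Fin k → Fin n) → Coord n → ℝ) (i a b : Fin n)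
    (J : Fin k → Fin n) (p : Coord n) :
    hCovVec ℓ (hCovVec ℓ T) i (Fin.cons a (Fin.cons b J)) p =
      covDir ℓ a (covDir ℓ b T) i J p - ∑ m, hCoeff ℓ m b a p * covDir ℓ m T i J p := by
  have hb : (fun i (J : Fin k → Fin n) => hCovVec ℓ T i (Fin.cons b J)) = covDir ℓ b T := by
    ext i J; rw [hCovVec_cons]
  rw [← hb]
  simp only [hCovVec, Fin.tail_cons, Fin.cons_zero, covDir, tensorAct, argAct, fMat,
    Matrix.of_apply]
  rw [Fin.sum_univ_succ]
  simp only [Fin.cons_zero, Fin.cons_succ, Fin.update_cons_zero, ← Fin.cons_update, Fin.tail_cons]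
  ring_nf

/-- The Ricci identity for the iterated h-covariant derivative. -/
lemma covDir_covDir_sub (h : IsLocalFinsler ℓ U)
    (hI : ∀ p ∈ U, ∀ i j k, hBracket ℓ i j k p = 0)
    {T : Fin n → (Fin k → Fin n) → Coord n → ℝ} (hT : ∀ i J, ContDiffOn ℝ ∞ (T i J) U)
    (hp : p ∈ U) (a b i : Fin n) (J : Fin k → Fin n) :
    covDir ℓ a (covDir ℓ b T) i J p - covDir ℓ b (covDir ℓ a T) i J p =
      -tensorAct (curvMat ℓ a b p) (fun i J => T i J p) i J := by
  have hTd (i J) : DifferentiableAt ℝ (T i J) p := h.differentiableAt (hT i J) hp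
  have dF := h.differentiableAt_fMat hp
  have d1 (b i J) : DifferentiableAt ℝ (fun q => ∑ m, fMat ℓ b q i m * T m J q) p :=
    DifferentiableAt.fun_sum fun m _ => (dF b i m).fun_mul (hTd m J)
  have d2 (b i J) : DifferentiableAt ℝ
      (fun q => argAct (fMat ℓ b q) (fun J => T i J q) J) p :=
    DifferentiableAt.fun_sum fun s _ => DifferentiableAt.fun_sum fun m _ =>
      (dF b m (J s)).fun_mul (hTd i _)
  have second (a b i J) : hder ℓ a (covDir ℓ b T i J) p = hder ℓ a (hder ℓ b (T i J)) p
      + (tensorAct (hderMat ℓ a (fMat ℓ b) p) (fun i J => T i J p) i J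
      + tensorAct (fMat ℓ b p) (fun i J => hder ℓ a (T i J) p) i J) := by
    have e1 : hder ℓ a (covDir ℓ b T i J) p = hder ℓ a (hder ℓ b (T i J)) p
        + (hder ℓ a (fun q => ∑ m, fMat ℓ b q i m * T m J q) p
        - hder ℓ a (fun q => argAct (fMat ℓ b q) (fun J => T i J q) J) p) := by
      rw [← hder_sub (d1 b i J) (d2 b i J),
        ← hder_add (h.differentiableAt (h.contDiffOn_hder (hT i J) b) hp)
          ((d1 b i J).fun_sub (d2 b i J))]
      rfl
    have e2 : hder ℓ a (fun q => ∑ m, fMat ℓ b q i m * T m J q) p =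
        ∑ m, hderMat ℓ a (fMat ℓ b) p i m * T m J p
          + ∑ m, fMat ℓ b p i m * hder ℓ a (T m J) p := by
      rw [hder_sum fun m => (dF b i m).fun_mul (hTd m J), ← Finset.sum_add_distrib]
      exact Finset.sum_congr rfl fun m _ => hder_mul (dF b i m) (hTd m J) a
    have e3 : hder ℓ a (fun q => argAct (fMat ℓ b q) (fun J => T i J q) J) p =
        argAct (hderMat ℓ a (fMat ℓ b) p) (fun J => T i J p) J
          + argAct (fMat ℓ b p) (fun J => hder ℓ a (T i J) p) J := by
      simp only [argAct]
      rw [hder_sum fun s => DifferentiableAt.fun_sum fun m _ =>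
        (dF b m (J s)).fun_mul (hTd i _), ← Finset.sum_add_distrib]
      refine Finset.sum_congr rfl fun s _ => ?_
      rw [hder_sum fun m => (dF b m (J s)).fun_mul (hTd i _), ← Finset.sum_add_distrib]
      exact Finset.sum_congr rfl fun m _ => hder_mul (dF b m (J s)) (hTd i _) a
    rw [e1, e2, e3, tensorAct, tensorAct]
    ring
  -- The two terms with a single `hder` of `T` are exchanged by swapping `a` and `b`, so they drop
  -- out of the difference.
  have expand (a b) : covDir ℓ a (covDir ℓ b T) i J p = hder ℓ a (hder ℓ b (T i J)) p
      + tensorAct (hderMat ℓ a (fMat ℓ b) p) (fun i J => T i J p) i J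
      + tensorAct (fMat ℓ b p) (fun i J => hder ℓ a (T i J) p) i J
      + tensorAct (fMat ℓ a p) (fun i J => hder ℓ b (T i J) p) i J
      + tensorAct (fMat ℓ a p) (tensorAct (fMat ℓ b p) (fun i J => T i J p)) i J := by
    rw [covDir, second]
    have : tensorAct (fMat ℓ a p) (fun i J => covDir ℓ b T i J p) i J =
        tensorAct (fMat ℓ a p) (fun i J => hder ℓ b (T i J) p) i J
        + tensorAct (fMat ℓ a p) (tensorAct (fMat ℓ b p) (fun i J => T i J p)) i J :=
      tensorAct_fun_add _ _ _ i J
    rw [this]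
    ring
  have comm := tensorAct_tensorAct (fMat ℓ a p) (fMat ℓ b p) (fun i J => T i J p) i J
  rw [tensorAct_sub] at comm
  rw [expand, expand, h.hder_comm hI (hT i J) hp a b, IsLocalFinsler.curvMat_eq hI hp, tensorAct_add,
    tensorAct_sub, tensorAct_sub]
  linarith

/-- The corrections for the direction slot agree in both orders by `hCoeff_comm`. -/
lemma hCovVec_hCovVec_sub (h : IsLocalFinsler ℓ U)
    (hI : ∀ p ∈ U, ∀ i j k, hBracket ℓ i j k p = 0)
    {T : Fin n → (Fin k → Fin n) → Coord n → ℝ} (hT : ∀ i J, ContDiffOn ℝ ∞ (T i J) U)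
    (hp : p ∈ U) (a b i : Fin n) (J : Fin k → Fin n) :
    hCovVec ℓ (hCovVec ℓ T) i (Fin.cons a (Fin.cons b J)) p
      - hCovVec ℓ (hCovVec ℓ T) i (Fin.cons b (Fin.cons a J)) p =
      -tensorAct (curvMat ℓ a b p) (fun i J => T i J p) i J := by
  rw [← covDir_covDir_sub h hI hT hp, hCovVec_hCovVec_cons, hCovVec_hCovVec_cons]
  simp only [h.hCoeff_comm hp _ b a]
  ring

/-- A recurrent tensor is 2-recurrent: if `∇T = A ⊗ T` then `∇∇T = (∇A + A ⊗ A) ⊗ T`. -/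
lemma hCovVec_hCovVec_of_recurrent (hU : IsOpen U)
    {T : Fin n → (Fin k → Fin n) → Coord n → ℝ} {A : (Fin 1 → Fin n) → Coord n → ℝ}
    (hT : ∀ i J, DifferentiableAt ℝ (T i J) p) (hA : ∀ J, DifferentiableAt ℝ (A J) p)
    (hrec : ∀ q ∈ U, ∀ i a J, hCovVec ℓ T i (Fin.cons a J) q = A ![a] q * T i J q)
    (hp : p ∈ U) (a b i : Fin n) (J : Fin k → Fin n) :
    hCovVec ℓ (hCovVec ℓ T) i (Fin.cons a (Fin.cons b J)) p =
      (hCovForm ℓ A ![a, b] p + A ![a] p * A ![b] p) * T i J p := by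
  simp only [hCovVec_cons] at hrec
  -- The recurrence holds on the open set `U`, so it may be differentiated at `p`.
  have hs : covDir ℓ a (covDir ℓ b T) i J p =
      hder ℓ a (A ![b]) p * T i J p + A ![b] p * covDir ℓ a T i J p := by
    rw [covDir, hder_congr hU hp (fun q hq => hrec q hq i b J), hder_mul (hA _) (hT i J)]
    have : (fun i J => covDir ℓ b T i J p) = fun i J => A ![b] p * T i J p := by
      ext i J; exact hrec p hp i b J
    rw [this, covDir]
    have : tensorAct (fMat ℓ a p) (fun i J => A ![b] p * T i J p) i J =
        A ![b] p * tensorAct (fMat ℓ a p) (fun i J => T i J p) i J := by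
      simp only [tensorAct, argAct_fun_mul, mul_sub, Finset.mul_sum, mul_left_comm]
    rw [this]
    ring
  have hf : hCovForm ℓ A ![a, b] p =
      hder ℓ a (A ![b]) p - ∑ m, hCoeff ℓ m b a p * A ![m] p := by
    have ht : Fin.tail ![a, b] = ![b] := by ext s; fin_cases s; rfl
    have hu (m : Fin n) : Function.update ![b] 0 m = ![m] := by ext s; fin_cases s; rfl
    simp [hCovForm, ht, hu]
  rw [hCovVec_hCovVec_cons, hs, hf]
  simp only [hrec p hp, ← mul_assoc, ← Finset.sum_mul]
  ring

end Covariant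

/-! ### Skew operators on tensor products and their eigenvalues. -/

section SkewOperators

open scoped Kronecker

variable {ι κ : Type*} [Fintype ι] [Fintype κ]

lemma kronecker_one_mulVec [DecidableEq κ] (A : Matrix ι ι ℝ) (v : ι × κ → ℝ) (i : ι) (j : κ) :
    ((A ⊗ₖ (1 : Matrix κ κ ℝ)).mulVec v) (i, j) = ∑ m, A i m * v (m, j) := by
  simp [Matrix.mulVec, dotProduct, Fintype.sum_prod_type, Matrix.kroneckerMap_apply,
    Matrix.one_apply]

lemma one_kronecker_mulVec [DecidableEq ι] (A : Matrix κ κ ℝ) (v : ι × κ → ℝ) (i : ι) (j : κ) :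
    (((1 : Matrix ι ι ℝ) ⊗ₖ A).mulVec v) (i, j) = A.mulVec (fun m => v (i, m)) j := by
  simp only [Matrix.mulVec, dotProduct, Fintype.sum_prod_type, Matrix.kroneckerMap_apply,
    Matrix.one_apply]
  rw [Finset.sum_eq_single i]
  · simp
  · intro m _ hm
    simp [hm.symm]
  · simp

/-- Leibniz rule: infinitesimal isometries of `H` and `H'` combine to one of `H ⊗ H'`. -/
lemma skew_kronecker [DecidableEq ι] [DecidableEq κ] {H M : Matrix ι ι ℝ} {H' M' : Matrix κ κ ℝ}
    (h : M.transpose * H + H * M = 0) (h' : M'.transpose * H' + H' * M' = 0) :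
    (M ⊗ₖ (1 : Matrix κ κ ℝ) + (1 : Matrix ι ι ℝ) ⊗ₖ M').transpose * (H ⊗ₖ H')
      + (H ⊗ₖ H') * (M ⊗ₖ (1 : Matrix κ κ ℝ) + (1 : Matrix ι ι ℝ) ⊗ₖ M') = 0 := by
  have e1 := congrArg (fun X => X ⊗ₖ H') h
  have e2 := congrArg (fun X => H ⊗ₖ X) h'
  simp only [Matrix.add_kronecker, Matrix.kronecker_add, Matrix.zero_kronecker,
    Matrix.kronecker_zero] at e1 e2
  rw [Matrix.transpose_add, Matrix.add_mul, Matrix.mul_add, ← Matrix.kroneckerMap_transpose,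
    ← Matrix.kroneckerMap_transpose, ← Matrix.mul_kronecker_mul, ← Matrix.mul_kronecker_mul,
    ← Matrix.mul_kronecker_mul, ← Matrix.mul_kronecker_mul]
  simp only [Matrix.transpose_one, Matrix.one_mul, Matrix.mul_one]
  rw [add_add_add_comm, e1, e2, add_zero]

/-- Evaluating the skewness identity on the eigenvector gives `0 = 2 c (v ⬝ᵥ H v)`, and the last
factor is positive. -/
lemma eq_zero_of_skew_mulVec_eq_smul {H M : Matrix ι ι ℝ} (hH : H.PosDef)
    (h : M.transpose * H + H * M = 0) {v : ι → ℝ} {c : ℝ} (hv : M.mulVec v = c • v)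
    (hv0 : v ≠ 0) : c = 0 := by
  have hpos : 0 < v ⬝ᵥ H.mulVec v := by simpa using hH.dotProduct_mulVec_pos hv0
  have h1 : v ⬝ᵥ (M.transpose * H + H * M).mulVec v = 2 * c * (v ⬝ᵥ H.mulVec v) := by
    rw [Matrix.add_mulVec, dotProduct_add, ← Matrix.mulVec_mulVec, ← Matrix.mulVec_mulVec, hv,
      Matrix.dotProduct_mulVec v M.transpose, Matrix.vecMul_transpose, hv, Matrix.mulVec_smul,
      smul_dotProduct, dotProduct_smul, smul_eq_mul]
    ring
  rw [h, Matrix.zero_mulVec, dotProduct_zero] at h1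
  have := mul_eq_zero.1 h1.symm
  rcases this with h2 | h2
  · linarith
  · exact absurd h2 hpos.ne'

end SkewOperators

section TensorAlgebra

open scoped Kronecker

variable {n : ℕ} {g K : Matrix (Fin n) (Fin n) ℝ}

/-- Covariant slots carry the dual endomorphism `-Kᵀ` and the dual metric `g⁻¹`; multiply the
hypothesis by `g⁻¹` on both sides. -/
lemma skew_inv (hg : g.PosDef) (h : K.transpose * g + g * K = 0) :
    (-K.transpose).transpose * g⁻¹ + g⁻¹ * (-K.transpose) = 0 := by
  have hu : IsUnit g.det := hg.det_pos.ne'.isUnit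
  have h1 : g⁻¹ * (K.transpose * g + g * K) * g⁻¹ = g⁻¹ * K.transpose + K * g⁻¹ := by
    rw [Matrix.mul_add, Matrix.add_mul, Matrix.nonsing_inv_mul_cancel_left _ _ hu,
      ← Matrix.mul_assoc, Matrix.mul_nonsing_inv_cancel_right _ _ hu]
  rw [h, Matrix.mul_zero, Matrix.zero_mul] at h1
  rw [Matrix.transpose_neg, Matrix.transpose_transpose, Matrix.neg_mul, Matrix.mul_neg,
    ← neg_add, add_comm, ← h1, neg_zero]

/-- A `g`-skew endomorphism has no non-zero eigenvalue on tensors. -/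
lemma eq_zero_of_tensorAct_eq_mul (hg : g.PosDef) (h : K.transpose * g + g * K = 0)
    {T : Fin n → (Fin 3 → Fin n) → ℝ} {c : ℝ} (hT : ∀ i J, tensorAct K T i J = c * T i J)
    (hne : ∃ i J, T i J ≠ 0) : c = 0 := by
  have hi := skew_inv hg h
  -- The inner product induced on tensors with one upper and three lower indices; `v` below is `T`
  -- as a vector indexed by quadruples.
  have hH := hg.kronecker (hg.inv.kronecker (hg.inv.kronecker hg.inv))
  have hS := skew_kronecker h (skew_kronecker hi (skew_kronecker hi hi))
  let v : Fin n × Fin n × Fin n × Fin n → ℝ := fun x => T x.1 ![x.2.1, x.2.2.1, x.2.2.2]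
  refine eq_zero_of_skew_mulVec_eq_smul hH hS (v := v) ?_ ?_
  · ext ⟨i, a, b, d⟩
    have := hT i ![a, b, d]
    simp only [Matrix.add_mulVec, Pi.add_apply, kronecker_one_mulVec, one_kronecker_mulVec]
    simp only [Matrix.mulVec, dotProduct, v, Matrix.neg_apply, Matrix.transpose_apply,
      Pi.smul_apply, smul_eq_mul]
    rw [← this, tensorAct, argAct, Fin.sum_univ_three]
    have u0 (m) : Function.update ![a, b, d] 0 m = ![m, b, d] := by
      ext s; fin_cases s <;> rfl
    have u1 (m) : Function.update ![a, b, d] 1 m = ![a, m, d] := by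
      ext s; fin_cases s <;> rfl
    have u2 (m) : Function.update ![a, b, d] 2 m = ![a, b, m] := by
      ext s; fin_cases s <;> rfl
    simp [u0, u1, u2]
    ring
  · obtain ⟨i, J, hJ⟩ := hne
    intro h0
    apply hJ
    have := congrFun h0 (i, J 0, J 1, J 2)
    have e : ![J 0, J 1, J 2] = J := by ext s; fin_cases s <;> rfl
    simpa [v, e] using this

end TensorAlgebra

lemma vec3_eta {α : Type*} (J : Fin 3 → α) : ![J 0, J 1, J 2] = J := by
  ext s; fin_cases s <;> rfl

lemma curvAct_eq {n k : ℕ} (ℓ : Coord n → ℝ) (a b : Fin n)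
    (θ : (Fin k → Fin n) → Coord n → ℝ) (J : Fin k → Fin n) (p : Coord n) :
    curvAct ℓ a b θ J p = -argAct (curvMat ℓ a b p) (fun J => θ J p) J := rfl

/-! ### Lowering an index, and the invariance of products of the metric. -/

section Lowering

variable {n : ℕ} {g K : Matrix (Fin n) (Fin n) ℝ}

lemma argAct_four (K : Matrix (Fin n) (Fin n) ℝ) (θ : (Fin 4 → Fin n) → ℝ) (J : Fin 4 → Fin n) :
    argAct K θ J = ∑ m, K m (J 0) * θ ![m, J 1, J 2, J 3] + ∑ m, K m (J 1) * θ ![J 0, m, J 2, J 3]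
      + ∑ m, K m (J 2) * θ ![J 0, J 1, m, J 3] + ∑ m, K m (J 3) * θ ![J 0, J 1, J 2, m] := by
  have u0 (m) : Function.update J 0 m = ![m, J 1, J 2, J 3] := by ext s; fin_cases s <;> rfl
  have u1 (m) : Function.update J 1 m = ![J 0, m, J 2, J 3] := by ext s; fin_cases s <;> rfl
  have u2 (m) : Function.update J 2 m = ![J 0, J 1, m, J 3] := by ext s; fin_cases s <;> rfl
  have u3 (m) : Function.update J 3 m = ![J 0, J 1, J 2, m] := by ext s; fin_cases s <;> rfl
  simp only [argAct, Fin.sum_univ_four, u0, u1, u2, u3]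

lemma argAct_three (K : Matrix (Fin n) (Fin n) ℝ) (θ : (Fin 3 → Fin n) → ℝ) (J : Fin 3 → Fin n) :
    argAct K θ J = ∑ m, K m (J 0) * θ ![m, J 1, J 2] + ∑ m, K m (J 1) * θ ![J 0, m, J 2]
      + ∑ m, K m (J 2) * θ ![J 0, J 1, m] := by
  have u0 (m) : Function.update J 0 m = ![m, J 1, J 2] := by ext s; fin_cases s <;> rfl
  have u1 (m) : Function.update J 1 m = ![J 0, m, J 2] := by ext s; fin_cases s <;> rfl
  have u2 (m) : Function.update J 2 m = ![J 0, J 1, m] := by ext s; fin_cases s <;> rfl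
  simp only [argAct, Fin.sum_univ_three, u0, u1, u2]

lemma skew_apply (hg : g.transpose = g) (h : K.transpose * g + g * K = 0) (i j : Fin n) :
    ∑ m, K m i * g m j = -∑ m, K m j * g m i := by
  have := congrFun (congrFun h i) j
  simp only [Matrix.add_apply, Matrix.mul_apply, Matrix.transpose_apply, Matrix.zero_apply] at this
  have e : ∑ m, g i m * K m j = ∑ m, K m j * g m i :=
    Finset.sum_congr rfl fun m _ => by rw [mul_comm, ← hg, Matrix.transpose_apply, hg]
  linarith

/-- Lowering the upper index commutes with the action of skew endomorphisms. -/
lemma argAct_lower (hg : g.transpose = g) (h : K.transpose * g + g * K = 0)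
    (T : Fin n → (Fin 3 → Fin n) → ℝ) (J : Fin 4 → Fin n) :
    argAct K (fun J => ∑ i, g i (J 3) * T i ![J 0, J 1, J 2]) J =
      -∑ i, g i (J 3) * tensorAct K T i ![J 0, J 1, J 2] := by
  have swap (f : Fin n → Fin n → ℝ) (s : Fin n) :
      ∑ m, K m s * ∑ i, g i (J 3) * f i m = ∑ i, g i (J 3) * ∑ m, K m s * f i m := by
    simp only [Finset.mul_sum]
    rw [Finset.sum_comm]
    exact Finset.sum_congr rfl fun _ _ => Finset.sum_congr rfl fun _ _ => by ring
  -- Skewness moves `K` from the lowered index to the upper index of `T`, at the cost of a sign.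
  have last : ∑ m, K m (J 3) * ∑ i, g i m * T i ![J 0, J 1, J 2] =
      -∑ i, g i (J 3) * ∑ m, K i m * T m ![J 0, J 1, J 2] := by
    have h1 : ∑ m, K m (J 3) * ∑ i, g i m * T i ![J 0, J 1, J 2] =
        ∑ i, (∑ m, K m (J 3) * g m i) * T i ![J 0, J 1, J 2] := by
      simp only [Finset.mul_sum, Finset.sum_mul]
      rw [Finset.sum_comm]
      refine Finset.sum_congr rfl fun i _ => Finset.sum_congr rfl fun m _ => ?_
      rw [← mul_assoc]
      conv_lhs => rw [← hg, Matrix.transpose_apply]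
    rw [h1]
    simp only [skew_apply hg h (J 3), neg_mul, Finset.sum_neg_distrib, Finset.mul_sum,
      Finset.sum_mul]
    rw [Finset.sum_comm]
    exact congrArg _ (Finset.sum_congr rfl fun _ _ => Finset.sum_congr rfl fun _ _ => by ring)
  rw [argAct_four]
  simp only [tensorAct, argAct_three, mul_sub, mul_add, Finset.sum_sub_distrib,
    Finset.sum_add_distrib]
  simp only [Matrix.cons_val_zero, Matrix.cons_val_one, Matrix.cons_val, swap]
  rw [last]
  ring

/-- A skew `K` annihilates `g`, hence by the Leibniz rule every product of copies of `g`; this one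
is `G` with its index lowered. -/
lemma argAct_metric_product (hg : g.transpose = g) (h : K.transpose * g + g * K = 0)
    (J : Fin 4 → Fin n) :
    argAct K (fun J => g (J 0) (J 2) * g (J 1) (J 3) - g (J 1) (J 2) * g (J 0) (J 3)) J = 0 := by
  have hc (i j) : g i j = g j i := by rw [← hg, Matrix.transpose_apply, hg]
  have left (c : ℝ) (s j : Fin n) : ∑ m, K m s * (g m j * c) = (∑ m, K m s * g m j) * c := by
    simp only [Finset.sum_mul, mul_assoc]
  have right (c : ℝ) (s j : Fin n) : ∑ m, K m s * (c * g m j) = (∑ m, K m s * g m j) * c := by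
    simp only [Finset.sum_mul, mul_comm c, mul_assoc]
  have left' (c : ℝ) (s j : Fin n) : ∑ m, K m s * (g j m * c) = (∑ m, K m s * g m j) * c := by
    simp only [hc j, left]
  have right' (c : ℝ) (s j : Fin n) : ∑ m, K m s * (c * g j m) = (∑ m, K m s * g m j) * c := by
    simp only [hc j, right]
  rw [argAct_four]
  simp only [Matrix.cons_val_zero, Matrix.cons_val_one, Matrix.cons_val, mul_sub,
    Finset.sum_sub_distrib, left, right, left', right']
  have sk := skew_apply hg h
  linear_combination g (J 1) (J 3) * sk (J 0) (J 2) - g (J 1) (J 2) * sk (J 0) (J 3)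
    + g (J 0) (J 2) * sk (J 1) (J 3) - g (J 0) (J 3) * sk (J 1) (J 2)

end Lowering

/-! ### Consequences for the concircular tensor in a chart. -/

namespace IsLocalFinsler

variable {n : ℕ} {ℓ : Coord n → ℝ} {U : Set (Coord n)} {p : Coord n}

lemma gMat_transpose (h : IsLocalFinsler ℓ U) (hp : p ∈ U) :
    (gMat ℓ p).transpose = gMat ℓ p := by
  ext i j; exact h.metric_comm hp j i

/-- If `∇∇C = α ⊗ C`, then the curvature acts on `C` by the skew part of `α`. -/
lemma tensorAct_concircT_eq_mul (h : IsLocalFinsler ℓ U)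
    (hI : ∀ p ∈ U, ∀ i j k, hBracket ℓ i j k p = 0) {α : Fin n → Fin n → ℝ} (hp : p ∈ U)
    (hα : ∀ i a b J, hCovVec ℓ (hCovVec ℓ (concircT ℓ)) i (Fin.cons a (Fin.cons b J)) p =
      α a b * concircT ℓ i J p) (a b i : Fin n) (J : Fin 3 → Fin n) :
    tensorAct (curvMat ℓ a b p) (fun i J => concircT ℓ i J p) i J =
      (α b a - α a b) * concircT ℓ i J p := by
  have := hCovVec_hCovVec_sub h hI (T := concircT ℓ)
    (fun i J => h.contDiffOn_concirc i (J 0) (J 1) (J 2)) hp a b i J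
  rw [hα, hα] at this
  linarith

/-- The difference `α b a - α a b` is a real eigenvalue of a skew operator with eigenvector `C ≠ 0`.
-/
lemma recurrence_symm (h : IsLocalFinsler ℓ U)
    (hI : ∀ p ∈ U, ∀ i j k, hBracket ℓ i j k p = 0) {α : Fin n → Fin n → ℝ} (hp : p ∈ U)
    (hα : ∀ i a b J, hCovVec ℓ (hCovVec ℓ (concircT ℓ)) i (Fin.cons a (Fin.cons b J)) p =
      α a b * concircT ℓ i J p) (hne : ∃ i J, concircT ℓ i J p ≠ 0) (a b : Fin n) :
    α a b = α b a := by
  have := eq_zero_of_tensorAct_eq_mul (h.posDef p hp) (h.curvMat_skew hI hp a b)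
    (h.tensorAct_concircT_eq_mul hI hp hα a b) hne
  linarith

lemma tensorAct_concircT_eq_zero (h : IsLocalFinsler ℓ U)
    (hI : ∀ p ∈ U, ∀ i j k, hBracket ℓ i j k p = 0) {α : Fin n → Fin n → ℝ} (hp : p ∈ U)
    (hα : ∀ i a b J, hCovVec ℓ (hCovVec ℓ (concircT ℓ)) i (Fin.cons a (Fin.cons b J)) p =
      α a b * concircT ℓ i J p) (a b i : Fin n) (J : Fin 3 → Fin n) :
    tensorAct (curvMat ℓ a b p) (fun i J => concircT ℓ i J p) i J = 0 := by
  rw [h.tensorAct_concircT_eq_mul hI hp hα]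
  by_cases hne : ∃ i J, concircT ℓ i J p ≠ 0
  · rw [h.recurrence_symm hI hp hα hne a b, sub_self, zero_mul]
  · push Not at hne
    rw [hne, mul_zero]

lemma curvAct_boldC_eq_zero (h : IsLocalFinsler ℓ U)
    (hI : ∀ p ∈ U, ∀ i j k, hBracket ℓ i j k p = 0) {α : Fin n → Fin n → ℝ} (hp : p ∈ U)
    (hα : ∀ i a b J, hCovVec ℓ (hCovVec ℓ (concircT ℓ)) i (Fin.cons a (Fin.cons b J)) p =
      α a b * concircT ℓ i J p) (a b : Fin n) (J : Fin 4 → Fin n) :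
    curvAct ℓ a b (boldC ℓ) J p = 0 := by
  have := argAct_lower (h.gMat_transpose hp) (h.curvMat_skew hI hp a b)
    (fun i J => concircT ℓ i J p) J
  simp only [h.tensorAct_concircT_eq_zero hI hp hα, mul_zero, Finset.sum_const_zero,
    neg_zero] at this
  rw [curvAct_eq, neg_eq_zero]
  exact this

/-- The action is algebraic at `p`, so the scalar curvature enters only as a constant factor. -/
lemma curvAct_boldR (h : IsLocalFinsler ℓ U)
    (hI : ∀ p ∈ U, ∀ i j k, hBracket ℓ i j k p = 0) (hp : p ∈ U) (a b : Fin n)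
    (J : Fin 4 → Fin n) : curvAct ℓ a b (boldR ℓ) J p = curvAct ℓ a b (boldC ℓ) J p := by
  have e (J : Fin 4 → Fin n) : boldR ℓ J p = boldC ℓ J p
      + scalarCurv ℓ p / ((n : ℝ) * ((n : ℝ) - 1)) *
        (gMat ℓ p (J 0) (J 2) * gMat ℓ p (J 1) (J 3)
          - gMat ℓ p (J 1) (J 2) * gMat ℓ p (J 0) (J 3)) := by
    have hG : ∑ i, metric ℓ i (J 3) p * tensorG ℓ i (J 0) (J 1) (J 2) p =
        gMat ℓ p (J 0) (J 2) * gMat ℓ p (J 1) (J 3)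
          - gMat ℓ p (J 1) (J 2) * gMat ℓ p (J 0) (J 3) := by
      simp only [tensorG, mul_sub, Finset.sum_sub_distrib, mul_ite, mul_one, mul_zero,
        Finset.sum_ite_eq', Finset.mem_univ, if_true, gMat, Matrix.of_apply]
      ring
    rw [← hG, boldR, boldC, Finset.mul_sum, ← Finset.sum_add_distrib]
    exact Finset.sum_congr rfl fun i _ => by rw [concirc]; ring
  rw [curvAct_eq, curvAct_eq]
  simp only [e]
  rw [argAct_fun_add, argAct_fun_mul,
    argAct_metric_product (h.gMat_transpose hp) (h.curvMat_skew hI hp a b), mul_zero, add_zero]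

end IsLocalFinsler

/-! ### Passage from charts to the manifold. -/

section Charts

variable {n : ℕ} {M : Type*} [TopologicalSpace M]

lemma isOpen_slitDomain (e : OpenPartialHomeomorph M (EuclideanSpace ℝ (Fin n))) :
    IsOpen (slitDomain e) :=
  (e.open_target.preimage continuous_fst).inter (isOpen_ne.preimage continuous_snd)

variable [ChartedSpace (EuclideanSpace ℝ (Fin n)) M]

/-- Keeps the chart expression of `L` off the zero section, where smoothness is not assumed. -/
lemma mfderiv_symm_ne_zero {e : OpenPartialHomeomorph M (EuclideanSpace ℝ (Fin n))}
    (he : e ∈ IsManifold.maximalAtlas (𝓡 n) ∞ M) {p : Coord n} (hp : p ∈ slitDomain e) :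
    mfderiv (𝓡 n) (𝓡 n) e.symm p.1 p.2 ≠ 0 := by
  have hd : e.MDifferentiable (𝓡 n) (𝓡 n) :=
    ⟨(contMDiffOn_of_mem_maximalAtlas he).mdifferentiableOn (by simp),
      (contMDiffOn_symm_of_mem_maximalAtlas he).mdifferentiableOn (by simp)⟩
  intro h
  exact hp.2 (hd.symm.mfderiv_injective hp.1 (h.trans (map_zero _).symm))

lemma TwoConcircularlyRecurrent.hCovVec_hCovVec {L : TangentBundle (𝓡 n) M → ℝ}
    {α : PiForm n M 2} (hα : TwoConcircularlyRecurrent L α)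
    {e : OpenPartialHomeomorph M (EuclideanSpace ℝ (Fin n))}
    (he : e ∈ IsManifold.maximalAtlas (𝓡 n) ∞ M) {p : Coord n} (hp : p ∈ slitDomain e)
    (i a b : Fin n) (J : Fin 3 → Fin n) :
    hCovVec (inChart L e) (hCovVec (inChart L e) (concircT (inChart L e))) i
      (Fin.cons a (Fin.cons b J)) p =
    formComp α e ![a, b] p * concircT (inChart L e) i J p := by
  have := hα.recurrent e he p hp i a b (J 0) (J 1) (J 2)
  rw [vec3_eta J] at this
  exact this

variable [IsManifold (𝓡 n) ∞ M]

lemma contMDiffOn_tangentMap_symm {e : OpenPartialHomeomorph M (EuclideanSpace ℝ (Fin n))}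
    (he : e ∈ IsManifold.maximalAtlas (𝓡 n) ∞ M) :
    ContMDiffOn 𝓘(ℝ, Coord n) (𝓡 n).tangent ∞
      (fun p : Coord n => tangentMap (𝓡 n) (𝓡 n) e.symm ⟨p.1, p.2⟩) (slitDomain e) := by
  have hs := contMDiffOn_symm_of_mem_maximalAtlas he
  have hu : UniqueMDiffOn (𝓡 n) e.target := e.open_target.uniqueMDiffOn
  have h1 := hs.contMDiffOn_tangentMapWithin (m := ∞) (by simp) hu
  have h2 : ContMDiff 𝓘(ℝ, Coord n) ((𝓡 n).prod (𝓡 n)) ∞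
      (fun p : Coord n => ((p.1, p.2) :
        ModelProd (EuclideanSpace ℝ (Fin n)) (EuclideanSpace ℝ (Fin n)))) :=
    contDiff_fst.contMDiff.prodMk contDiff_snd.contMDiff
  rw [chartedSpaceSelf_prod] at h2
  have h3 : ContMDiff 𝓘(ℝ, Coord n) (𝓡 n).tangent ∞
      (fun p : Coord n => (⟨p.1, p.2⟩ : TangentBundle (𝓡 n) (EuclideanSpace ℝ (Fin n)))) :=
    contMDiff_tangentBundleModelSpaceHomeomorph_symm.comp h2
  refine (h1.comp h3.contMDiffOn fun p hp => hp.1).congr fun p hp => ?_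
  exact (tangentMapWithin_eq_tangentMap (hu _ hp.1)
    ((hs.contMDiffAt (e.open_target.mem_nhds hp.1)).mdifferentiableAt (by simp))).symm

lemma IsFinsler.isLocalFinsler {L : TangentBundle (𝓡 n) M → ℝ} (hL : IsFinsler L)
    {e : OpenPartialHomeomorph M (EuclideanSpace ℝ (Fin n))}
    (he : e ∈ IsManifold.maximalAtlas (𝓡 n) ∞ M) :
    IsLocalFinsler (inChart L e) (slitDomain e) where
  isOpen := isOpen_slitDomain e
  smooth := (hL.smooth.comp (contMDiffOn_tangentMap_symm he)
    fun _ hp => mfderiv_symm_ne_zero he hp).contDiffOn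
  posDef := hL.posDef e he

lemma eq_on_closure {X : Type*} [TopologicalSpace X] {U S : Set X} (hSU : S ⊆ U) {f g : X → ℝ}
    (hf : ContinuousOn f U) (hg : ContinuousOn g U) (h : ∀ p ∈ S, f p = g p) :
    ∀ p ∈ U ∩ closure S, f p = g p := by
  rintro p ⟨hpU, hpS⟩
  have : (nhdsWithin p S).NeBot := mem_closure_iff_nhdsWithin_neBot.1 hpS
  exact tendsto_nhds_unique_of_eventuallyEq ((hf p hpU).mono hSU) ((hg p hpU).mono hSU)
    (Filter.eventually_of_mem self_mem_nhdsWithin h)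

/-- Supplies the continuity of `∇A` needed to pass to the closure of `{C ≠ 0}`. -/
lemma contDiffOn_hCovForm {L : TangentBundle (𝓡 n) M → ℝ} (hL : IsFinsler L)
    {k : ℕ} {θ : PiForm n M k} (hθ : IsRecurrenceForm θ)
    {e : OpenPartialHomeomorph M (EuclideanSpace ℝ (Fin n))}
    (he : e ∈ IsManifold.maximalAtlas (𝓡 n) ∞ M) (J : Fin (k + 1) → Fin n) :
    ContDiffOn ℝ ∞ (hCovForm (inChart L e) (formComp θ e) J) (slitDomain e) :=
  have h := hL.isLocalFinsler he
  (h.contDiffOn_hder (hθ.smooth e he _) _).sub <| ContDiffOn.sum fun _ _ =>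
    ContDiffOn.sum fun _ _ => (h.contDiffOn_hCoeff _ _ _).mul (hθ.smooth e he _)

lemma ConcircularlyRecurrent.hCovVec_hCovVec {L : TangentBundle (𝓡 n) M → ℝ}
    (hL : IsFinsler L) {A : PiForm n M 1} (hA : ConcircularlyRecurrent L A)
    {e : OpenPartialHomeomorph M (EuclideanSpace ℝ (Fin n))}
    (he : e ∈ IsManifold.maximalAtlas (𝓡 n) ∞ M) {p : Coord n} (hp : p ∈ slitDomain e)
    (i a b : Fin n) (J : Fin 3 → Fin n) :
    hCovVec (inChart L e) (hCovVec (inChart L e) (concircT (inChart L e))) i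
      (Fin.cons a (Fin.cons b J)) p =
    (hCovForm (inChart L e) (formComp A e) ![a, b] p
      + formComp A e ![a] p * formComp A e ![b] p) * concircT (inChart L e) i J p := by
  have h := hL.isLocalFinsler he
  refine hCovVec_hCovVec_of_recurrent h.isOpen
    (fun i J => h.differentiableAt (h.contDiffOn_concirc i (J 0) (J 1) (J 2)) hp)
    (fun J => h.differentiableAt (hA.form.smooth e he J) hp) (fun q hq i a J => ?_) hp a b i J
  have := hA.recurrent e he q hq i a (J 0) (J 1) (J 2)
  rw [vec3_eta J] at this
  exact this

/-- The argument is pointwise, so an unstructured array `α` chosen separately at each point suffices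
and serves both kinds of recurrence. -/
lemma curvActs_trivially {L : TangentBundle (𝓡 n) M → ℝ} (hL : IsFinsler L)
    (hI : HorizontallyIntegrable L)
    (h : ∀ e ∈ IsManifold.maximalAtlas (𝓡 n) ∞ M, ∀ p ∈ slitDomain e,
      ∃ α : Fin n → Fin n → ℝ, ∀ i a b J,
        hCovVec (inChart L e) (hCovVec (inChart L e) (concircT (inChart L e))) i
          (Fin.cons a (Fin.cons b J)) p = α a b * concircT (inChart L e) i J p) :
    CurvActsTriviallyOnC L ∧ CurvActsTriviallyOnR L := by
  have hC : CurvActsTriviallyOnC L := fun e he p hp a b J => by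
    obtain ⟨α, hα⟩ := h e he p hp
    exact (hL.isLocalFinsler he).curvAct_boldC_eq_zero (hI e he) hp hα a b J
  refine ⟨hC, fun e he p hp a b J => ?_⟩
  rw [(hL.isLocalFinsler he).curvAct_boldR (hI e he) hp]
  exact hC e he p hp a b J

end Charts

end FinslerGeom

theorem mainTheorem8 {n : ℕ} (hn : 3 ≤ n) {M : Type*} [TopologicalSpace M]
    [ChartedSpace (EuclideanSpace ℝ (Fin n)) M] [IsManifold (𝓡 n) ∞ M]
    (L : TangentBundle (𝓡 n) M → ℝ) (hL : IsFinsler L) (hI : HorizontallyIntegrable L) :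
    (∀ A : PiForm n M 1, ConcircularlyRecurrent L A →
      (∀ e ∈ IsManifold.maximalAtlas (𝓡 n) ∞ M,
        ∀ p ∈ slitDomain e ∩ closure (concircNonzero L e), ∀ a b,
          hCovForm (inChart L e) (formComp A e) ![a, b] p =
            hCovForm (inChart L e) (formComp A e) ![b, a] p) ∧
      CurvActsTriviallyOnC L ∧ CurvActsTriviallyOnR L) ∧
    (∀ α : PiForm n M 2, TwoConcircularlyRecurrent L α →
      (∀ e ∈ IsManifold.maximalAtlas (𝓡 n) ∞ M,
        ∀ p ∈ slitDomain e ∩ closure (concircNonzero L e), ∀ a b,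
          formComp α e ![a, b] p = formComp α e ![b, a] p) ∧
      CurvActsTriviallyOnC L ∧ CurvActsTriviallyOnR L) := by
  refine ⟨fun A hA => ⟨fun e he p hp a b => ?_, curvActs_trivially hL hI fun e he p hp =>
      ⟨_, fun i a b J => hA.hCovVec_hCovVec hL he hp i a b J⟩⟩,
    fun α hα => ⟨fun e he p hp a b => ?_, curvActs_trivially hL hI fun e he p hp =>
      ⟨fun a b => formComp α e ![a, b] p, fun i a b J => hα.hCovVec_hCovVec he hp i a b J⟩⟩⟩
  · refine eq_on_closure (fun _ hq => hq.1) (contDiffOn_hCovForm hL hA.form he _).continuousOn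
      (contDiffOn_hCovForm hL hA.form he _).continuousOn (fun q hq => ?_) p hp
    have := (hL.isLocalFinsler he).recurrence_symm (hI e he) hq.1
      (α := fun a b => hCovForm (inChart L e) (formComp A e) ![a, b] q
        + formComp A e ![a] q * formComp A e ![b] q)
      (fun i a b J => hA.hCovVec_hCovVec hL he hq.1 i a b J) hq.2 a b
    -- The products `A_a A_b` and `A_b A_a` cancel, leaving the symmetry of `∇A`.
    linarith
  · refine eq_on_closure (fun _ hq => hq.1) (hα.form.smooth e he _).continuousOn
      (hα.form.smooth e he _).continuousOn (fun q hq => ?_) p hp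
    exact (hL.isLocalFinsler he).recurrence_symm (hI e he) hq.1
      (α := fun a b => formComp α e ![a, b] q)
      (fun i a b J => hα.hCovVec_hCovVec he hq.1 i a b J) hq.2 a b
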